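/- **Setting.** Let $\Theta\subseteq\mathbb R^d$ be measurable and let $\{P_\alpha:\alpha\in\Theta\}$ be probability measures on a measurable space $\mathcal X$ with jointly measurable, strictly positive densities $p_\alpha(x)$ with respect to a $\sigma$-finite measure $\lambda$ ($\mathcal X$ is the common support). Let $\phi$ be a nonnegative function, $C^2$ and strictly convex on $(0,\infty)$, with $\phi(1)=0$. Fix $\theta_0\in\Theta$ (the true parameter) and $\theta\in\Theta$ (the escort parameter). Put $D_\phi(P_\theta,P_\alpha)=\int\phi(p_\theta/p_\alpha)\,dP_\alpha\in[0,\infty]$ and $\mathcal U=\{\alpha\in\Theta: D_\phi(P_\theta,P_\alpha)<\infty\}$; assume $\int|\phi'(p_\theta/p_\alpha)|\,p_\theta\,d\lambda<\infty$ for $\alpha\in\mathcal U$, and put $$h(\theta,\alpha,x)=\int\phi'\Big(\frac{p_\theta}{p_\alpha}\Big)p_\theta\,d\lambda-\Big[\frac{p_\theta(x)}{p_\alpha(x)}\phi'\Big(\frac{p_\theta(x)}{p_\alpha(x)}\Big)-\phi\Big(\frac{p_\theta(x)}{p_\alpha(x)}\Big)\Big].$$ Assume that $\theta_0$ is identifiable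 in the sense that for every $\delta>0$ the distance $\int|p_\alpha-p_{\theta_0}|\,d\lambda$ is bounded away from $0$ over $\alpha\in\mathcal U$ with $|\alpha-\theta_0|\ge\delta$. Let $X_1,X_2,\dots$ be i.i.d. with law $P_{\theta_0}$. For a function $f$ on $\mathcal X$ write $\mathbb P_nf=\frac1n\sum_{i\le n}f(X_i)$ and $P_{\theta_0}f=\int f\,dP_{\theta_0}$. Let $$S=-P_{\theta_0}\frac{\partial^2}{\partial\alpha^2}h(\theta,\theta_0),\qquad V=P_{\theta_0}\Big[\frac{\partial}{\partial\alpha}h(\theta,\theta_0)\,\frac{\partial}{\partial\alpha}h(\theta,\theta_0)^\top\Big],\qquad U_n(\theta_0)=\mathbb P_n\frac{\partial}{\partial\alpha}h(\theta,\theta_0),$$ and let $R_n(\alpha)$ be defined by $$\mathbb P_nh(\theta,\alpha)-\mathbb P_nh(\theta,\theta_0)=(\alpha-\theta_0)^\top U_n(\theta_0)-\tfrac12(\alpha-\theta_0)^\top S(\alpha-\theta_0)+R_n(\alpha).$$ **Conditions.** (R.1) $h(\theta,\alpha)$ is $P_{\theta_0}$-integrable for $\alpha\in\mathcal U$ and $\sup_{\alpha\in\mathcal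 U}|\mathbb P_nh(\theta,\alpha)-P_{\theta_0}h(\theta,\alpha)|\to0$ almost surely. (R.2) On some open neighbourhood $N\subseteq\mathcal U$ of $\theta_0$, for almost every $x$: the first and second order partial derivatives in $\alpha$ of $\phi'(p_\theta(x)/p_\alpha(x))\,p_\theta(x)$ exist and are dominated by a $\lambda$-integrable function of $x$; the partial derivatives of $h(\theta,\alpha,x)$ in $\alpha$ up to order three exist, and those of order three are dominated by a $P_{\theta_0}$-integrable function of $x$. (R.3) The first order partial derivatives of $h(\theta,\cdot,x)$ at $\theta_0$ are square integrable and those of the second order are integrable under $P_{\theta_0}$ (so that $S$ and $V$ exist), and $S$ and $V$ are nonsingular. (R.4) For every $\epsilon>0$ there is $\delta>0$ such that the probability of the event $\sup_{|\alpha-\theta_0|\le\delta}|R_n(\alpha)|\ge\epsilon$ tends to $0$ as $n\to\infty$. **Theorem 1.** Let $\pi\ge0$ be an integrable prior on $\Theta$ with $\int_\Theta|\alpha|\,\pi(\alpha)\,d\alpha<\infty$, continuous and positive at $\theta_0$, and let (R.1)–(R.4) hold. Let $$p_{\phi,n}(\alpha)=\frac{\exp\{n\mathbb P_nh(\theta,\alpha)\}\,\pi(\alpha)}{\int_{\mathcal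 U}\exp\{n\mathbb P_nh(\theta,\beta)\}\,\pi(\beta)\,d\beta}\quad(\alpha\in\mathcal U),\qquad p_{\phi,n}(\alpha)=0\quad(\alpha\notin\mathcal U)$$ be the $\phi$-posterior density, $\Delta_n=\theta_0+S^{-1}U_n(\theta_0)$, and let $p^*_{\phi,n}(t)=n^{-d/2}\,p_{\phi,n}(\Delta_n+t/\sqrt n)$ be the $\phi$-posterior density of $t=\sqrt n(\alpha-\Delta_n)$. Then $$\int_{\mathbb R^d}\Big|p^*_{\phi,n}(t)-\sqrt{\frac{\det S}{(2\pi)^d}}\,\exp\{-\tfrac12t^\top St\}\Big|\,dt\longrightarrow0\quad\text{in probability.}$$ -/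

import Mathlib

open MeasureTheory ProbabilityTheory Filter Topology Set
open scoped ENNReal Matrix

noncomputable section

namespace PhiPosterior

/-- The ambient parameter space `ℝ^d` with its Euclidean norm. -/
abbrev Param (d : ℕ) := EuclideanSpace ℝ (Fin d)

/-- A parametric model `{P_α : α ∈ Θ}` with `Θ ⊆ ℝ^d`, dominated by a `σ`-finite measure. The
observation space is the common support of the densities, so that all the ratios
`p_θ(x) / p_α(x)` lie in `(0, ∞)`. -/
structure Model (d : ℕ) (𝒳 : Type*) [MeasurableSpace 𝒳] where
  /-- the parameter set `Θ` -/
  Θ : Set (Param d)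
  /-- the dominating measure -/
  dom : Measure 𝒳
  /-- the densities `p_α(x)`; only their values for `α ∈ Θ` matter -/
  p : Param d → 𝒳 → ℝ
  measurableSet_Θ : MeasurableSet Θ
  sigmaFinite_dom : SigmaFinite dom
  measurable_p : Measurable (Function.uncurry p)
  p_pos : ∀ α ∈ Θ, ∀ x, 0 < p α x
  lintegral_p : ∀ α ∈ Θ, ∫⁻ x, ENNReal.ofReal (p α x) ∂dom = 1

/-- The convex functions generating the divergences: finite, nonnegative, `C²` and strictly convex
on `(0, ∞)`, with value `0` at `1`. -/
structure IsDivergenceGenerator (φ : ℝ → ℝ) : Prop where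
  contDiffOn : ContDiffOn ℝ 2 φ (Ioi 0)
  strictConvexOn : StrictConvexOn ℝ (Ioi 0) φ
  nonneg : ∀ u, 0 < u → 0 ≤ φ u
  map_one : φ 1 = 0

section Model

variable {d : ℕ} {𝒳 : Type*} [MeasurableSpace 𝒳]

/-- The probability measure `P_α`. -/
def Model.law (M : Model d 𝒳) (α : Param d) : Measure 𝒳 :=
  M.dom.withDensity fun x => ENNReal.ofReal (M.p α x)

/-- The likelihood ratio `p_θ(x) / p_α(x)`. -/
def Model.ratio (M : Model d 𝒳) (θ α : Param d) (x : 𝒳) : ℝ := M.p θ x / M.p α x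

/-- The divergence `D_φ(P_θ, P_α) = ∫ φ(p_θ / p_α) dP_α`, with values in `[0, ∞]`. -/
def divergence (φ : ℝ → ℝ) (M : Model d 𝒳) (θ α : Param d) : ℝ≥0∞ :=
  ∫⁻ x, ENNReal.ofReal (φ (M.ratio θ α x)) ∂(M.law α)

/-- The set `𝒰` of the `α ∈ Θ` at finite divergence, for the fixed escort parameter `θ`. -/
def finiteSet (φ : ℝ → ℝ) (M : Model d 𝒳) (θ : Param d) : Set (Param d) :=
  {α | α ∈ M.Θ ∧ divergence φ M θ α < ∞}

/-- The function `φ'(p_θ(x) / p_α(x)) p_θ(x)`. -/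
def dualIntegrand (φ : ℝ → ℝ) (M : Model d 𝒳) (θ α : Param d) (x : 𝒳) : ℝ :=
  deriv φ (M.ratio θ α x) * M.p θ x

/-- The function `h(θ, α, x)` of the dual form of the divergence. -/
def h (φ : ℝ → ℝ) (M : Model d 𝒳) (θ α : Param d) (x : 𝒳) : ℝ :=
  (∫ y, dualIntegrand φ M θ α y ∂M.dom) -
    (M.ratio θ α x * deriv φ (M.ratio θ α x) - φ (M.ratio θ α x))

/-- The parameters away from `θ₀` have laws away from `P_{θ₀}`: for every `δ > 0`, the `L¹` distance
of the densities is bounded away from `0` over the `α ∈ 𝒰` with `|α - θ₀| ≥ δ`. -/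
def SeparatedFrom (φ : ℝ → ℝ) (M : Model d 𝒳) (θ θ₀ : Param d) : Prop :=
  ∀ δ : ℝ, 0 < δ → ∃ η : ℝ, 0 < η ∧ ∀ α ∈ finiteSet φ M θ, δ ≤ ‖α - θ₀‖ →
    η ≤ ∫ x, |M.p α x - M.p θ₀ x| ∂M.dom

/-- The `i`-th partial derivative of a function on `ℝ^d`. -/
def pd (i : Fin d) (f : Param d → ℝ) : Param d → ℝ :=
  fun α => lineDeriv ℝ f α (EuclideanSpace.single i 1)

/-- All the partial derivatives of `f` of order at most `k` exist on `N`. -/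
def HasPartialsOn : ℕ → (Param d → ℝ) → Set (Param d) → Prop
  | 0, _, _ => True
  | k + 1, f, N => ∀ i : Fin d,
      (∀ α ∈ N, LineDifferentiableAt ℝ f α (EuclideanSpace.single i 1)) ∧
        HasPartialsOn k (pd i f) N

/-- The gradient `∂h(θ, α, x)/∂α` at `α`. -/
def gradH (φ : ℝ → ℝ) (M : Model d 𝒳) (θ α : Param d) (x : 𝒳) : Fin d → ℝ :=
  fun i => pd i (fun β => h φ M θ β x) α

/-- The matrix `∂²h(θ, α, x)/∂α²` at `α`. -/
def hessH (φ : ℝ → ℝ) (M : Model d 𝒳) (θ α : Param d) (x : 𝒳) : Matrix (Fin d) (Fin d) ℝ :=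
  Matrix.of fun i j => pd i (pd j fun β => h φ M θ β x) α

/-- `S = -P_{θ₀} ∂²h(θ, θ₀)/∂α²`. -/
def matS (φ : ℝ → ℝ) (M : Model d 𝒳) (θ θ₀ : Param d) : Matrix (Fin d) (Fin d) ℝ :=
  Matrix.of fun i j => -∫ x, hessH φ M θ θ₀ x i j ∂(M.law θ₀)

/-- `V = P_{θ₀} (∂h(θ, θ₀)/∂α) (∂h(θ, θ₀)/∂α)ᵀ`. -/
def matV (φ : ℝ → ℝ) (M : Model d 𝒳) (θ θ₀ : Param d) : Matrix (Fin d) (Fin d) ℝ :=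
  Matrix.of fun i j => ∫ x, gradH φ M θ θ₀ x i * gradH φ M θ θ₀ x j ∂(M.law θ₀)

/-- Regularity: on an open neighbourhood of `θ₀` (on which `h(θ, ·)` is defined) the first and
second partial derivatives of `φ'(p_θ / p_α) p_θ` in `α` exist and are dominated by an integrable
function, and the partial derivatives of `h(θ, α, x)` in `α` up to the third order exist, those of
the third order being dominated by a `P_{θ₀}`-integrable function. -/
def CondR2 (φ : ℝ → ℝ) (M : Model d 𝒳) (θ θ₀ : Param d) : Prop :=
  ∃ N : Set (Param d), IsOpen N ∧ θ₀ ∈ N ∧ N ⊆ finiteSet φ M θ ∧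
    (∃ G : 𝒳 → ℝ, Integrable G M.dom ∧ ∀ᵐ x ∂M.dom,
      HasPartialsOn 2 (fun β => dualIntegrand φ M θ β x) N ∧
      ∀ α ∈ N, ∀ i j : Fin d,
        |pd i (fun β => dualIntegrand φ M θ β x) α| ≤ G x ∧
        |pd i (pd j fun β => dualIntegrand φ M θ β x) α| ≤ G x) ∧
    (∃ H : 𝒳 → ℝ, Integrable H (M.law θ₀) ∧ ∀ᵐ x ∂(M.law θ₀),
      HasPartialsOn 3 (fun β => h φ M θ β x) N ∧
      ∀ α ∈ N, ∀ i j k : Fin d,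
        |pd i (pd j (pd k fun β => h φ M θ β x)) α| ≤ H x)

/-- The matrices `S` and `V` exist and are nonsingular. -/
structure CondR3 (φ : ℝ → ℝ) (M : Model d 𝒳) (θ θ₀ : Param d) : Prop where
  integrable_hess : ∀ i j, Integrable (fun x => hessH φ M θ θ₀ x i j) (M.law θ₀)
  memLp_grad : ∀ i, MemLp (fun x => gradH φ M θ θ₀ x i) 2 (M.law θ₀)
  det_S_ne_zero : (matS φ M θ θ₀).det ≠ 0
  det_V_ne_zero : (matV φ M θ θ₀).det ≠ 0

section Sample

variable {Ω : Type*}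

/-- The empirical mean `P_n f = (1/n) ∑ f(X_i)` over the first `n` observations. -/
def empMean (X : ℕ → Ω → 𝒳) (n : ℕ) (ω : Ω) (f : 𝒳 → ℝ) : ℝ :=
  (n : ℝ)⁻¹ * ∑ i ∈ Finset.range n, f (X i ω)

/-- `U_n(θ₀) = P_n ∂h(θ, θ₀)/∂α`. -/
def score (φ : ℝ → ℝ) (M : Model d 𝒳) (θ θ₀ : Param d) (X : ℕ → Ω → 𝒳) (n : ℕ) (ω : Ω) :
    Fin d → ℝ :=
  fun i => empMean X n ω fun x => gradH φ M θ θ₀ x i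

/-- `Δ_n = θ₀ + S⁻¹ U_n(θ₀)`. -/
def center (φ : ℝ → ℝ) (M : Model d 𝒳) (θ θ₀ : Param d) (X : ℕ → Ω → 𝒳) (n : ℕ) (ω : Ω) :
    Param d :=
  θ₀ + WithLp.toLp 2 ((matS φ M θ θ₀)⁻¹ *ᵥ score φ M θ θ₀ X n ω)

/-- The quadratic form `tᵀ S t`. -/
def quadForm (S : Matrix (Fin d) (Fin d) ℝ) (t : Param d) : ℝ := t.ofLp ⬝ᵥ (S *ᵥ t.ofLp)

/-- The remainder `R_n(α)` of the expansion
`P_n h(θ,α) - P_n h(θ,θ₀) = (α-θ₀)ᵀ U_n(θ₀) - (1/2) (α-θ₀)ᵀ S (α-θ₀) + R_n(α)`. -/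
def remainder (φ : ℝ → ℝ) (M : Model d 𝒳) (θ θ₀ : Param d) (X : ℕ → Ω → 𝒳) (n : ℕ) (ω : Ω)
    (α : Param d) : ℝ :=
  empMean X n ω (h φ M θ α) - empMean X n ω (h φ M θ θ₀)
    - (α - θ₀).ofLp ⬝ᵥ score φ M θ θ₀ X n ω
    + 1 / 2 * quadForm (matS φ M θ θ₀) (α - θ₀)

/-- The unnormalized `φ`-posterior density `exp(n P_n h(θ,α)) π(α)`. -/
def posteriorWeight (φ : ℝ → ℝ) (M : Model d 𝒳) (θ : Param d) (prior : Param d → ℝ)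
    (X : ℕ → Ω → 𝒳) (n : ℕ) (ω : Ω) (α : Param d) : ℝ :=
  Real.exp (n * empMean X n ω (h φ M θ α)) * prior α

/-- The `φ`-posterior density `p_{φ,n}`, carried by `𝒰`. -/
def posterior (φ : ℝ → ℝ) (M : Model d 𝒳) (θ : Param d) (prior : Param d → ℝ)
    (X : ℕ → Ω → 𝒳) (n : ℕ) (ω : Ω) (α : Param d) : ℝ :=
  (finiteSet φ M θ).indicator (posteriorWeight φ M θ prior X n ω) α /
    ∫ β in finiteSet φ M θ, posteriorWeight φ M θ prior X n ω β

/-- The `φ`-posterior density `p*_{φ,n}` of `t = √n (α - Δ_n)`, by change of variables. -/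
def rescaledPosterior (φ : ℝ → ℝ) (M : Model d 𝒳) (θ θ₀ : Param d) (prior : Param d → ℝ)
    (X : ℕ → Ω → 𝒳) (n : ℕ) (ω : Ω) (t : Param d) : ℝ :=
  (√(n : ℝ) ^ d)⁻¹ *
    posterior φ M θ prior X n ω ((√(n : ℝ))⁻¹ • t + center φ M θ θ₀ X n ω)

/-- The density at `t` of the centred Gaussian law on `ℝ^d` with precision matrix `S`. -/
def gaussianDensity (S : Matrix (Fin d) (Fin d) ℝ) (t : Param d) : ℝ :=
  √(S.det / (2 * Real.pi) ^ d) * Real.exp (-(1 / 2) * quadForm S t)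

variable [MeasurableSpace Ω]

/-- `sup_α |P_n h(θ,α) - P_{θ₀} h(θ,α)| → 0` almost surely, the means `P_{θ₀} h(θ,α)` being
defined. -/
structure CondR1 (φ : ℝ → ℝ) (M : Model d 𝒳) (θ θ₀ : Param d) (μ : Measure Ω)
    (X : ℕ → Ω → 𝒳) : Prop where
  integrable_h : ∀ α ∈ finiteSet φ M θ, Integrable (h φ M θ α) (M.law θ₀)
  tendsto_sup : ∀ᵐ ω ∂μ, Tendsto
    (fun n : ℕ => ⨆ α ∈ finiteSet φ M θ,
      ‖empMean X n ω (h φ M θ α) - ∫ x, h φ M θ α x ∂(M.law θ₀)‖ₑ) atTop (𝓝 0)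

/-- For every `ε > 0` there is `δ > 0` such that the probability of
`sup_{|α - θ₀| ≤ δ} |R_n(α)| ≥ ε` tends to `0`. -/
def CondR4 (φ : ℝ → ℝ) (M : Model d 𝒳) (θ θ₀ : Param d) (μ : Measure Ω)
    (X : ℕ → Ω → 𝒳) : Prop :=
  ∀ ε : ℝ, 0 < ε → ∃ δ : ℝ, 0 < δ ∧
    Tendsto (fun n : ℕ => μ {ω | ENNReal.ofReal ε ≤
      ⨆ α ∈ Metric.closedBall θ₀ δ, ‖remainder φ M θ θ₀ X n ω α‖ₑ}) atTop (𝓝 0)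

end Sample

end Model

end PhiPosterior

end

/-!
The gap `P_{θ₀} h(θ, θ₀) - P_{θ₀} h(θ, α)` is the mean of a Bregman divergence of `φ` between the
ratios `p_θ / p_{θ₀}` and `p_θ / p_α`. Hence `θ₀` maximizes the mean criterion, so that the mean
gradient vanishes at `θ₀` and the nonsingular matrix `S` is positive definite; and since a sequence
along which the gap tends to zero has densities converging in `L¹`, the maximum is well separated.
By a Taylor expansion and the law of large numbers, almost surely `P_n h(θ, ·)` is quadratic near
`θ₀` with Hessian close to `-S`, and by (R.1) it is smaller by a fixed amount away from `θ₀`. Along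
the indices where `√n U_n(θ₀)` stays bounded, Laplace's method then gives the convergence of the
rescaled posterior: the integrand is dominated by a Gaussian near `θ₀`, and the mass elsewhere is
exponentially small. Chebyshev's inequality makes `√n U_n(θ₀)` tight, which turns this into
convergence in probability along all indices.
-/

noncomputable section

namespace PhiPosterior

section QuadraticForm

variable {d : ℕ} {S : Matrix (Fin d) (Fin d) ℝ}

theorem quadForm_eq_sum (S : Matrix (Fin d) (Fin d) ℝ) (t : Param d) :
    quadForm S t = ∑ i, ∑ j, t i * t j * S i j := by
  simp only [quadForm, dotProduct, Matrix.mulVec, Finset.mul_sum]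
  exact Finset.sum_congr rfl fun i _ => Finset.sum_congr rfl fun j _ => by ring

theorem continuous_quadForm (S : Matrix (Fin d) (Fin d) ℝ) : Continuous (quadForm S) := by
  simp only [funext (quadForm_eq_sum S)]
  fun_prop

theorem measurable_gaussianDensity (S : Matrix (Fin d) (Fin d) ℝ) :
    Measurable (gaussianDensity S) :=
  (((continuous_quadForm S).const_mul _).rexp.const_mul _).measurable

theorem quadForm_smul (S : Matrix (Fin d) (Fin d) ℝ) (c : ℝ) (t : Param d) :
    quadForm S (c • t) = c ^ 2 * quadForm S t := by
  simp only [quadForm, WithLp.ofLp_smul, Matrix.mulVec_smul, dotProduct_smul, smul_dotProduct,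
    smul_eq_mul]
  ring

theorem quadForm_add_matrix (A B : Matrix (Fin d) (Fin d) ℝ) (t : Param d) :
    quadForm (A + B) t = quadForm A t + quadForm B t := by
  simp only [quadForm, Matrix.add_mulVec, dotProduct_add]

theorem quadForm_neg_matrix (A : Matrix (Fin d) (Fin d) ℝ) (t : Param d) :
    quadForm (-A) t = -quadForm A t := by
  simp only [quadForm, Matrix.neg_mulVec, dotProduct_neg]

theorem quadForm_sub (hS : S.IsSymm) (s t : Param d) :
    quadForm S (s - t) = quadForm S s + quadForm S t - 2 * (s.ofLp ⬝ᵥ (S *ᵥ t.ofLp)) := by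
  have hcomm : t.ofLp ⬝ᵥ (S *ᵥ s.ofLp) = s.ofLp ⬝ᵥ (S *ᵥ t.ofLp) := by
    rw [Matrix.dotProduct_mulVec, dotProduct_comm, ← Matrix.mulVec_transpose, hS.eq]
  simp only [quadForm, WithLp.ofLp_sub, Matrix.mulVec_sub, dotProduct_sub, sub_dotProduct, hcomm]
  ring

theorem abs_quadForm_le (A : Matrix (Fin d) (Fin d) ℝ) (t : Param d) :
    |quadForm A t| ≤ (∑ i, ∑ j, |A i j|) * ‖t‖ ^ 2 := by
  rw [quadForm_eq_sum, Finset.sum_mul]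
  refine (Finset.abs_sum_le_sum_abs _ _).trans (Finset.sum_le_sum fun i _ => ?_)
  rw [Finset.sum_mul]
  refine (Finset.abs_sum_le_sum_abs _ _).trans (Finset.sum_le_sum fun j _ => ?_)
  rw [abs_mul, abs_mul, mul_comm, sq]
  gcongr <;> exact PiLp.norm_apply_le t _

open scoped MatrixOrder Matrix.Norms.L2Operator in
theorem exists_quadForm_eq_norm_sq (hS : S.PosSemidef) : ∃ T : Param d →ₗ[ℝ] Param d,
    LinearMap.det T ^ 2 = S.det ∧ ∀ t, quadForm S t = ‖T t‖ ^ 2 := by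
  obtain ⟨B, rfl⟩ := CStarAlgebra.nonneg_iff_eq_star_mul_self.mp hS.nonneg
  refine ⟨Matrix.toLpLin 2 2 B, ?_, fun t => ?_⟩
  · rw [LinearMap.det_toLpLin, Matrix.det_mul, Matrix.star_eq_conjTranspose,
      Matrix.det_conjTranspose, star_trivial, sq]
  · rw [EuclideanSpace.real_norm_sq_eq, quadForm, ← Matrix.mulVec_mulVec,
      Matrix.star_eq_conjTranspose, Matrix.conjTranspose_eq_transpose_of_trivial,
      Matrix.mulVec_transpose, dotProduct_comm, ← Matrix.dotProduct_mulVec]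
    simp only [dotProduct, Matrix.toLpLin_apply, sq]

theorem exists_mul_norm_sq_le_quadForm (hS : S.PosDef) :
    ∃ c : ℝ, 0 < c ∧ ∀ t : Param d, c * ‖t‖ ^ 2 ≤ quadForm S t := by
  obtain ⟨T, hdet, hT⟩ := exists_quadForm_eq_norm_sq hS.posSemidef
  have hdet0 : LinearMap.det T ≠ 0 := (pow_ne_zero_iff two_ne_zero).1 (hdet ▸ hS.det_pos.ne')
  obtain ⟨K, hK, hanti⟩ := T.exists_antilipschitzWith
    (LinearMap.ker_eq_bot.2 (LinearMap.equivOfDetNeZero _ hdet0).injective)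
  refine ⟨((K : ℝ) ^ 2)⁻¹, by positivity, fun t => ?_⟩
  have hle : ‖t‖ ≤ K * ‖T t‖ := by
    simpa only [map_zero, dist_zero_right] using hanti.le_mul_dist t 0
  rw [hT, inv_mul_le_iff₀ (by positivity), ← mul_pow]
  gcongr

theorem integral_exp_neg_half_quadForm (hS : S.PosDef) :
    ∫ t : Param d, Real.exp (-(1 / 2) * quadForm S t) = √((2 * Real.pi) ^ d / S.det) := by
  obtain ⟨T, hdet, hT⟩ := exists_quadForm_eq_norm_sq hS.posSemidef
  have hdet0 : LinearMap.det T ≠ 0 := (pow_ne_zero_iff two_ne_zero).1 (hdet ▸ hS.det_pos.ne')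
  have hmap := integral_map (μ := (volume : Measure (Param d)))
    T.continuous_of_finiteDimensional.aemeasurable
    (f := fun u => Real.exp (-(1 / 2) * ‖u‖ ^ 2)) (by fun_prop : Continuous _).aestronglyMeasurable
  simp_rw [hT]
  rw [← hmap, Measure.map_linearMap_addHaar_eq_smul_addHaar _ hdet0, integral_smul_measure,
    GaussianFourier.integral_rexp_neg_mul_sq_norm (by norm_num), ← hdet,
    ENNReal.toReal_ofReal (abs_nonneg _), Real.sqrt_div' _ (sq_nonneg _), Real.sqrt_sq_eq_abs,
    abs_inv, finrank_euclideanSpace_fin, smul_eq_mul, inv_mul_eq_div, Real.sqrt_eq_rpow,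
    ← Real.rpow_natCast, ← Real.rpow_mul (by positivity)]
  congr 2 <;> ring

theorem integral_exp_neg_half_quadForm_pos (hS : S.PosDef) :
    0 < ∫ t : Param d, Real.exp (-(1 / 2) * quadForm S t) := by
  have := hS.det_pos
  rw [integral_exp_neg_half_quadForm hS]
  positivity

theorem integrable_exp_neg_half_quadForm (hS : S.PosDef) :
    Integrable fun t : Param d => Real.exp (-(1 / 2) * quadForm S t) :=
  .of_integral_ne_zero (integral_exp_neg_half_quadForm_pos hS).ne'

theorem gaussianDensity_eq_div_integral (hS : S.PosDef) (t : Param d) :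
    gaussianDensity S t = Real.exp (-(1 / 2) * quadForm S t) /
      ∫ u : Param d, Real.exp (-(1 / 2) * quadForm S u) := by
  rw [integral_exp_neg_half_quadForm hS, gaussianDensity, div_eq_inv_mul (Real.exp _),
    ← Real.sqrt_inv, inv_div]

end QuadraticForm

section Calculus

variable {d : ℕ}

/-- The vector of the first partial derivatives. -/
def pdVec (f : Param d → ℝ) (x : Param d) : Fin d → ℝ := fun i => pd i f x

/-- The matrix of the second partial derivatives. -/
def pdMat (f : Param d → ℝ) (x : Param d) : Matrix (Fin d) (Fin d) ℝ :=
  Matrix.of fun i j => pd i (pd j f) x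

theorem hasDerivAt_comp_line {E F : Type*} [NormedAddCommGroup E] [NormedSpace ℝ E]
    [NormedAddCommGroup F] [NormedSpace ℝ F] {f : E → F} {f' : F} {x v : E} {t : ℝ}
    (hf : HasLineDerivAt ℝ f f' (x + t • v) v) : HasDerivAt (fun s : ℝ => f (x + s • v)) f' t := by
  rw [HasLineDerivAt, ← sub_self t] at hf
  simpa only [sub_smul, add_assoc, add_sub_cancel] using hf.comp_sub_const t t

theorem norm_sub_le_of_forall_mem_uIcc {a b x : Param d} (hx : ∀ i, x i ∈ uIcc (a i) (b i)) :
    ‖x - a‖ ≤ ‖b - a‖ := by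
  rw [EuclideanSpace.norm_eq, EuclideanSpace.norm_eq]
  gcongr with i
  exact abs_sub_left_of_mem_uIcc (hx i)

theorem abs_sub_le_of_abs_pd_le_on_segment {f : Param d → ℝ} {x : Param d} {j : Fin d} {s K : ℝ}
    (hf : ∀ t ∈ uIcc 0 s, LineDifferentiableAt ℝ f (x + t • EuclideanSpace.single j 1)
      (EuclideanSpace.single j 1))
    (hK : ∀ t ∈ uIcc 0 s, |pd j f (x + t • EuclideanSpace.single j 1)| ≤ K) :
    |f (x + s • EuclideanSpace.single j 1) - f x| ≤ K * |s| := by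
  have := (convex_uIcc 0 s).norm_image_sub_le_of_norm_hasDerivWithin_le
    (fun t ht => (hasDerivAt_comp_line (hf t ht).hasLineDerivAt).hasDerivWithinAt) hK
    left_mem_uIcc right_mem_uIcc
  simpa only [Real.norm_eq_abs, zero_smul, add_zero, sub_zero] using this

theorem piecewise_add_smul_single_mem_uIcc {a b : Param d} {s : Finset (Fin d)} {j : Fin d}
    (hj : j ∉ s) {t : ℝ} (ht : t ∈ uIcc 0 (b j - a j)) (i : Fin d) :
    (WithLp.toLp 2 (s.piecewise b.ofLp a.ofLp) + t • EuclideanSpace.single j (1 : ℝ)) i ∈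
      uIcc (a i) (b i) := by
  rcases eq_or_ne i j with rfl | hij
  · have : a i + t ∈ uIcc (a i) (b i) := by
      rcases mem_uIcc.1 ht with h | h
      · exact mem_uIcc.2 (.inl ⟨by linarith [h.1], by linarith [h.2]⟩)
      · exact mem_uIcc.2 (.inr ⟨by linarith [h.1], by linarith [h.2]⟩)
    simpa [hj] using this
  · by_cases his : i ∈ s <;> simp [hij, his]

theorem abs_sub_le_of_forall_abs_pd_le {f : Param d → ℝ} {a b : Param d} {r K : ℝ}
    (hf : ∀ x ∈ Metric.ball a r, ∀ i, LineDifferentiableAt ℝ f x (EuclideanSpace.single i 1))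
    (hK : ∀ x ∈ Metric.ball a r, ∀ i, |pd i f x| ≤ K) (hb : b ∈ Metric.ball a r) :
    |f b - f a| ≤ d * K * ‖b - a‖ := by
  have hbox : ∀ x : Param d, (∀ i, x i ∈ uIcc (a i) (b i)) → x ∈ Metric.ball a r := fun x hx =>
    mem_ball_iff_norm.2 ((norm_sub_le_of_forall_mem_uIcc hx).trans_lt (mem_ball_iff_norm.1 hb))
  suffices hstep : ∀ s : Finset (Fin d),
      |f (WithLp.toLp 2 (s.piecewise b.ofLp a.ofLp)) - f a| ≤ s.card * K * ‖b - a‖ by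
    simpa using hstep Finset.univ
  intro s
  induction s using Finset.induction_on with
  | empty => simp
  | insert j s hj ih =>
    set p : Param d := WithLp.toLp 2 (s.piecewise b.ofLp a.ofLp) with hp
    set e : Param d := EuclideanSpace.single j 1
    have hnext : WithLp.toLp 2 ((insert j s).piecewise b.ofLp a.ofLp) = p + (b j - a j) • e := by
      ext i
      rcases eq_or_ne i j with rfl | hij
      · simp [hp, e, hj]
      · simp [hp, e, hij, Finset.piecewise]
    have hmem : ∀ t ∈ uIcc 0 (b j - a j), p + t • e ∈ Metric.ball a r := fun t ht =>
      hbox _ (piecewise_add_smul_single_mem_uIcc hj ht)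
    have hK0 : 0 ≤ K := (abs_nonneg _).trans (hK _ (hmem 0 left_mem_uIcc) j)
    rw [hnext, Finset.card_insert_of_notMem hj]
    calc |f (p + (b j - a j) • e) - f a|
        ≤ |f (p + (b j - a j) • e) - f p| + |f p - f a| := abs_sub_le _ _ _
      _ ≤ K * |b j - a j| + s.card * K * ‖b - a‖ := add_le_add
          (abs_sub_le_of_abs_pd_le_on_segment (fun t ht => hf _ (hmem t ht) j)
            fun t ht => hK _ (hmem t ht) j) ih
      _ ≤ K * ‖b - a‖ + s.card * K * ‖b - a‖ := by
          gcongr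
          exact PiLp.norm_apply_le (b - a) j
      _ = (s.card + 1 : ℕ) * K * ‖b - a‖ := by push_cast; ring

theorem continuousAt_of_forall_abs_pd_le {f : Param d → ℝ} {N : Set (Param d)} {K : ℝ}
    {a : Param d} (hN : N ∈ 𝓝 a)
    (hf : ∀ x ∈ N, ∀ i, LineDifferentiableAt ℝ f x (EuclideanSpace.single i 1))
    (hK : ∀ x ∈ N, ∀ i, |pd i f x| ≤ K) : ContinuousAt f a := by
  obtain ⟨r, hr, hsub⟩ := Metric.mem_nhds_iff.1 hN
  refine continuousAt_of_locally_lipschitz hr (d * K) fun x hx => ?_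
  rw [dist_eq_norm, dist_eq_norm]
  exact abs_sub_le_of_forall_abs_pd_le (fun y hy => hf y (hsub hy)) (fun y hy => hK y (hsub hy)) hx

theorem hasFDerivAt_of_continuousAt_pd {f : Param d → ℝ} {a : Param d}
    (hf : ∀ᶠ x in 𝓝 a, ∀ i, LineDifferentiableAt ℝ f x (EuclideanSpace.single i 1))
    (hc : ∀ i, ContinuousAt (pd i f) a) :
    HasFDerivAt f (∑ i, pd i f a • (EuclideanSpace.proj i : Param d →L[ℝ] ℝ)) a := by
  set L : Param d →L[ℝ] ℝ := ∑ i, pd i f a • EuclideanSpace.proj i with hL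
  have hLsingle : ∀ i, L (EuclideanSpace.single i 1) = pd i f a := fun i => by simp [hL]
  refine .of_isLittleO (Asymptotics.isLittleO_iff.2 fun c hc0 => ?_)
  have hclose : ∀ᶠ x in 𝓝 a, ∀ i, |pd i f x - pd i f a| < c / (d + 1) :=
    eventually_all.2 fun i => Metric.tendsto_nhds.1 (hc i) _ (by positivity)
  obtain ⟨r, hr, hball⟩ := Metric.eventually_nhds_iff_ball.1 (hf.and hclose)
  have hline : ∀ x ∈ Metric.ball a r, ∀ i, HasLineDerivAt ℝ (fun y => f y - L y)
      (pd i f x - pd i f a) x (EuclideanSpace.single i 1) := fun x hx i =>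
    HasDerivAt.fun_sub ((hball x hx).1 i).hasLineDerivAt
      (hLsingle i ▸ (L.hasFDerivAt (x := x)).hasLineDerivAt _)
  filter_upwards [Metric.ball_mem_nhds a hr] with x hx
  have hle := abs_sub_le_of_forall_abs_pd_le (K := c / (d + 1))
    (fun y hy i => (hline y hy i).lineDifferentiableAt)
    (fun y hy i => by rw [pd, (hline y hy i).lineDeriv]; exact ((hball y hy).2 i).le) hx
  calc ‖f x - f a - L (x - a)‖ = |(f x - L x) - (f a - L a)| := by
        rw [map_sub, Real.norm_eq_abs]; congr 1; ring
    _ ≤ d * (c / (d + 1)) * ‖x - a‖ := hle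
    _ ≤ c * ‖x - a‖ := by
        gcongr
        rw [← mul_div_assoc, div_le_iff₀ (by positivity)]
        linarith

theorem abs_sub_sub_sub_half_le_of_hasDerivAt {g g' g'' : ℝ → ℝ} {B : ℝ}
    (hg : ∀ t ∈ Icc (0 : ℝ) 1, HasDerivAt g (g' t) t)
    (hg' : ∀ t ∈ Icc (0 : ℝ) 1, HasDerivAt g' (g'' t) t)
    (hB : ∀ t ∈ Icc (0 : ℝ) 1, |g'' t - g'' 0| ≤ B) :
    |g 1 - g 0 - g' 0 - 1 / 2 * g'' 0| ≤ B := by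
  have hfirst : ∀ t ∈ Icc (0 : ℝ) 1, ‖g' t - g' 0 - t * g'' 0‖ ≤ B := by
    intro t ht
    have hmvt := (convex_Icc (0 : ℝ) 1).norm_image_sub_le_of_norm_hasDerivWithin_le
      (f := fun s => g' s - s * g'' 0) (f' := fun s => g'' s - g'' 0)
      (fun s hs => by simpa using
        ((hg' s hs).fun_sub ((hasDerivAt_id s).mul_const (g'' 0))).hasDerivWithinAt)
      hB (left_mem_Icc.2 zero_le_one) ht
    have hB0 : 0 ≤ B := (abs_nonneg _).trans (hB t ht)
    calc ‖g' t - g' 0 - t * g'' 0‖ = ‖g' t - t * g'' 0 - (g' 0 - 0 * g'' 0)‖ := by congr 1; ring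
      _ ≤ B * ‖t - 0‖ := hmvt
      _ ≤ B := by
          rw [sub_zero, Real.norm_of_nonneg ht.1]
          exact mul_le_of_le_one_right hB0 ht.2
  have hmvt := norm_image_sub_le_of_norm_deriv_le_segment_01'
    (f := fun s => g s - s * g' 0 - s ^ 2 / 2 * g'' 0) (C := B)
    (fun s hs => by simpa using (((hg s hs).fun_sub ((hasDerivAt_id s).mul_const (g' 0))).fun_sub
      ((((hasDerivAt_id s).fun_pow 2).div_const 2).mul_const (g'' 0))).hasDerivWithinAt)
    fun s hs => hfirst s ⟨hs.1, hs.2.le⟩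
  calc |g 1 - g 0 - g' 0 - 1 / 2 * g'' 0|
      = ‖g 1 - 1 * g' 0 - 1 ^ 2 / 2 * g'' 0 - (g 0 - 0 * g' 0 - 0 ^ 2 / 2 * g'' 0)‖ := by
        rw [Real.norm_eq_abs]; congr 1; ring
    _ ≤ B := hmvt

theorem HasPartialsOn.mono {N N' : Set (Param d)} (hN : N' ⊆ N) :
    ∀ {k : ℕ} {f : Param d → ℝ}, HasPartialsOn k f N → HasPartialsOn k f N'
  | 0, _, _ => trivial
  | _ + 1, _, hf => fun i => ⟨fun x hx => (hf i).1 x (hN hx), (hf i).2.mono hN⟩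

/-- All partial derivatives of `f` up to order three exist on `N`, and those of order three are
bounded there by `K`. -/
structure HasBoundedThirdPartialsOn (f : Param d → ℝ) (N : Set (Param d)) (K : ℝ) : Prop where
  hasPartialsOn : HasPartialsOn 3 f N
  abs_le : ∀ x ∈ N, ∀ i j k : Fin d, |pd i (pd j (pd k f)) x| ≤ K

/-- The second-order Taylor expansion of `f` at `a` with gradient `g` and Hessian `Q` has a cubic
error with constant `K` on the ball of radius `r`. Stating it for arbitrary `g` and `Q` makes it
stable under averaging over `f`. -/
def TaylorBound (r : ℝ) (a : Param d) (f : Param d → ℝ) (g : Fin d → ℝ)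
    (Q : Matrix (Fin d) (Fin d) ℝ) (K : ℝ) : Prop :=
  ∀ v : Param d, ‖v‖ < r →
    |f (a + v) - f a - v.ofLp ⬝ᵥ g - 1 / 2 * quadForm Q v| ≤ K * ‖v‖ ^ 3

namespace HasBoundedThirdPartialsOn

variable {f : Param d → ℝ} {N : Set (Param d)} {K : ℝ} {a : Param d}

theorem mono {N' : Set (Param d)} (hf : HasBoundedThirdPartialsOn f N K) (hN : N' ⊆ N) :
    HasBoundedThirdPartialsOn f N' K :=
  ⟨hf.hasPartialsOn.mono hN, fun x hx => hf.abs_le x (hN hx)⟩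

theorem continuousAt_pd_pd (hf : HasBoundedThirdPartialsOn f N K) (hN : N ∈ 𝓝 a) (i j : Fin d) :
    ContinuousAt (pd i (pd j f)) a :=
  continuousAt_of_forall_abs_pd_le hN (fun x hx k => (((hf.hasPartialsOn j).2 i).2 k).1 x hx)
    fun x hx k => hf.abs_le x hx k i j

theorem hasFDerivAt_pd (hf : HasBoundedThirdPartialsOn f N K) (hN : N ∈ 𝓝 a) (j : Fin d) :
    HasFDerivAt (pd j f) (∑ i, pd i (pd j f) a • (EuclideanSpace.proj i : Param d →L[ℝ] ℝ)) a :=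
  hasFDerivAt_of_continuousAt_pd
    (by filter_upwards [hN] with x hx i using ((hf.hasPartialsOn j).2 i).1 x hx)
    fun i => hf.continuousAt_pd_pd hN i j

theorem hasFDerivAt (hf : HasBoundedThirdPartialsOn f N K) (hN : N ∈ 𝓝 a) :
    HasFDerivAt f (∑ i, pd i f a • (EuclideanSpace.proj i : Param d →L[ℝ] ℝ)) a :=
  hasFDerivAt_of_continuousAt_pd
    (by filter_upwards [hN] with x hx i using (hf.hasPartialsOn i).1 x hx)
    fun i => (hf.hasFDerivAt_pd hN i).continuousAt

theorem isSymm_pdMat (hf : HasBoundedThirdPartialsOn f N K) (hN : N ∈ 𝓝 a) :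
    (pdMat f a).IsSymm := by
  have hfirst : ∀ᶠ x in 𝓝 a, HasFDerivAt f
      (∑ i, pd i f x • (EuclideanSpace.proj i : Param d →L[ℝ] ℝ)) x := by
    filter_upwards [eventually_mem_nhds_iff.2 hN] with x hx using hf.hasFDerivAt hx
  have hsecond := HasFDerivAt.fun_sum (u := Finset.univ) fun k _ =>
    (hf.hasFDerivAt_pd hN k).smul_const (EuclideanSpace.proj k : Param d →L[ℝ] ℝ)
  ext i j
  simpa [pdMat, _root_.sum_apply] using second_derivative_symmetric_of_eventually hfirst hsecond
    (EuclideanSpace.single j 1) (EuclideanSpace.single i 1)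

theorem hasDerivAt_line (hf : HasBoundedThirdPartialsOn f N K) {v : Param d} {t : ℝ}
    (hN : N ∈ 𝓝 (a + t • v)) :
    HasDerivAt (fun s : ℝ => f (a + s • v)) (v.ofLp ⬝ᵥ pdVec f (a + t • v)) t := by
  convert! hasDerivAt_comp_line ((hf.hasFDerivAt hN).hasLineDerivAt v) using 1
  simp [dotProduct, pdVec, mul_comm]

theorem hasDerivAt_dotProduct_pdVec_line (hf : HasBoundedThirdPartialsOn f N K) {v : Param d}
    {t : ℝ} (hN : N ∈ 𝓝 (a + t • v)) :
    HasDerivAt (fun s : ℝ => v.ofLp ⬝ᵥ pdVec f (a + s • v))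
      (quadForm (pdMat f (a + t • v)) v) t := by
  convert! HasDerivAt.fun_sum (u := Finset.univ) fun j _ =>
    (hasDerivAt_comp_line ((hf.hasFDerivAt_pd hN j).hasLineDerivAt v)).const_mul (v j) using 1
  simp only [quadForm_eq_sum, _root_.sum_apply, Finset.mul_sum]
  rw [Finset.sum_comm]
  refine Finset.sum_congr rfl fun j _ => Finset.sum_congr rfl fun i _ => ?_
  simp only [pdMat, Matrix.of_apply, _root_.smul_apply, PiLp.proj_apply, smul_eq_mul]
  ring

theorem abs_quadForm_pdMat_sub_le {r : ℝ} (hf : HasBoundedThirdPartialsOn f (Metric.ball a r) K)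
    {b : Param d} (hb : b ∈ Metric.ball a r) (v : Param d) :
    |quadForm (pdMat f b) v - quadForm (pdMat f a) v| ≤ d ^ 3 * K * ‖b - a‖ * ‖v‖ ^ 2 := by
  have hentry : ∀ i j, |(pdMat f b + -pdMat f a) i j| ≤ d * K * ‖b - a‖ := fun i j =>
    abs_sub_le_of_forall_abs_pd_le (fun x hx k => (((hf.hasPartialsOn j).2 i).2 k).1 x hx)
      (fun x hx k => hf.abs_le x hx k i j) hb
  rw [sub_eq_add_neg, ← quadForm_neg_matrix, ← quadForm_add_matrix]
  refine (abs_quadForm_le _ v).trans ?_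
  gcongr
  calc ∑ i, ∑ j, |(pdMat f b + -pdMat f a) i j|
      ≤ ∑ _i : Fin d, ∑ _j : Fin d, d * K * ‖b - a‖ :=
        Finset.sum_le_sum fun i _ => Finset.sum_le_sum fun j _ => hentry i j
    _ = d ^ 3 * K * ‖b - a‖ := by
        simp only [Finset.sum_const, Finset.card_univ, Fintype.card_fin, nsmul_eq_mul]
        ring

theorem taylorBound {r : ℝ} (hf : HasBoundedThirdPartialsOn f (Metric.ball a r) K) :
    TaylorBound r a f (pdVec f a) (pdMat f a) (d ^ 3 * K) := by
  intro v hv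
  have hnorm : ∀ t ∈ Icc (0 : ℝ) 1, ‖a + t • v - a‖ ≤ ‖v‖ := fun t ht => by
    rw [add_sub_cancel_left, norm_smul, Real.norm_of_nonneg ht.1]
    exact mul_le_of_le_one_left (norm_nonneg v) ht.2
  have hmem : ∀ t ∈ Icc (0 : ℝ) 1, a + t • v ∈ Metric.ball a r := fun t ht =>
    mem_ball_iff_norm.2 ((hnorm t ht).trans_lt hv)
  have hnhds : ∀ t ∈ Icc (0 : ℝ) 1, Metric.ball a r ∈ 𝓝 (a + t • v) := fun t ht =>
    Metric.isOpen_ball.mem_nhds (hmem t ht)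
  have hK : 0 ≤ d ^ 3 * K := by
    rcases d.eq_zero_or_pos with rfl | hd
    · simp
    · have := (abs_nonneg _).trans
        (hf.abs_le _ (hmem 0 (left_mem_Icc.2 zero_le_one)) ⟨0, hd⟩ ⟨0, hd⟩ ⟨0, hd⟩)
      positivity
  have htaylor := abs_sub_sub_sub_half_le_of_hasDerivAt (B := d ^ 3 * K * ‖v‖ ^ 3)
    (fun t ht => hf.hasDerivAt_line (hnhds t ht))
    (fun t ht => hf.hasDerivAt_dotProduct_pdVec_line (hnhds t ht)) fun t ht => by
      rw [zero_smul, add_zero, pow_succ' ‖v‖ 2, ← mul_assoc]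
      refine (hf.abs_quadForm_pdMat_sub_le (hmem t ht) v).trans ?_
      gcongr
      exact hnorm t ht
  simpa only [one_smul, zero_smul, add_zero] using htaylor

end HasBoundedThirdPartialsOn

end Calculus

section TaylorBound

variable {d : ℕ} {𝒳 : Type*} [MeasurableSpace 𝒳] {ν : Measure 𝒳} {r K : ℝ} {a : Param d}
  {f : Param d → ℝ} {g : Fin d → ℝ} {Q : Matrix (Fin d) (Fin d) ℝ}

theorem integrable_dotProduct {g : 𝒳 → Fin d → ℝ} (hg : ∀ i, Integrable (fun x => g x i) ν)
    (v : Fin d → ℝ) : Integrable (fun x => v ⬝ᵥ g x) ν :=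
  integrable_finsetSum _ fun i _ => (hg i).const_mul (v i)

theorem integral_dotProduct {g : 𝒳 → Fin d → ℝ} (hg : ∀ i, Integrable (fun x => g x i) ν)
    (v : Fin d → ℝ) : ∫ x, v ⬝ᵥ g x ∂ν = v ⬝ᵥ fun i => ∫ x, g x i ∂ν := by
  simp only [dotProduct]
  rw [integral_finsetSum _ fun i _ => (hg i).const_mul (v i)]
  simp only [integral_const_mul]

theorem quadForm_eq_dotProduct_mulVec (Q : Matrix (Fin d) (Fin d) ℝ) (v : Param d) :
    quadForm Q v = v.ofLp ⬝ᵥ fun i => v.ofLp ⬝ᵥ Q i := by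
  rw [quadForm]
  congr 1 with i
  exact dotProduct_comm _ _

theorem integrable_quadForm {Q : 𝒳 → Matrix (Fin d) (Fin d) ℝ}
    (hQ : ∀ i j, Integrable (fun x => Q x i j) ν) (v : Param d) :
    Integrable (fun x => quadForm (Q x) v) ν := by
  simp only [quadForm_eq_dotProduct_mulVec]
  exact integrable_dotProduct (fun i => integrable_dotProduct (hQ i) v) v

theorem integral_quadForm {Q : 𝒳 → Matrix (Fin d) (Fin d) ℝ}
    (hQ : ∀ i j, Integrable (fun x => Q x i j) ν) (v : Param d) :
    ∫ x, quadForm (Q x) v ∂ν = quadForm (Matrix.of fun i j => ∫ x, Q x i j ∂ν) v := by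
  simp only [quadForm_eq_dotProduct_mulVec]
  rw [integral_dotProduct fun i => integrable_dotProduct (hQ i) v]
  congr 1 with i
  exact integral_dotProduct (hQ i) v

theorem TaylorBound.integral {F : Param d → 𝒳 → ℝ} {g : 𝒳 → Fin d → ℝ}
    {Q : 𝒳 → Matrix (Fin d) (Fin d) ℝ} {K : 𝒳 → ℝ}
    (hF : ∀ v, ‖v‖ < r → Integrable (F (a + v)) ν)
    (hg : ∀ i, Integrable (fun x => g x i) ν) (hQ : ∀ i j, Integrable (fun x => Q x i j) ν)
    (hK : Integrable K ν)
    (hT : ∀ᵐ x ∂ν, TaylorBound r a (fun α => F α x) (g x) (Q x) (K x)) :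
    TaylorBound r a (fun α => ∫ x, F α x ∂ν) (fun i => ∫ x, g x i ∂ν)
      (Matrix.of fun i j => ∫ x, Q x i j ∂ν) (∫ x, K x ∂ν) := by
  intro v hv
  have hF0 : Integrable (F a) ν := by
    simpa using hF 0 (by simpa using (norm_nonneg v).trans_lt hv)
  have hdiff : Integrable (fun x => F (a + v) x - F a x) ν := (hF v hv).sub hF0
  have hlin : Integrable (fun x => F (a + v) x - F a x - v.ofLp ⬝ᵥ g x) ν :=
    hdiff.sub (integrable_dotProduct hg v)
  have hquad := (integrable_quadForm hQ v).const_mul (1 / 2)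
  rw [← integral_quadForm hQ, ← integral_dotProduct hg, ← integral_sub (hF v hv) hF0,
    ← integral_sub hdiff (integrable_dotProduct hg v), ← integral_const_mul,
    ← integral_sub hlin hquad, ← integral_mul_const]
  refine abs_integral_le_integral_abs.trans
    (integral_mono_ae (hlin.sub hquad).abs (hK.mul_const _) ?_)
  filter_upwards [hT] with x hx using hx v hv

theorem TaylorBound.eventually_le_of_isMax (hr : 0 < r) (hT : TaylorBound r a f g Q K)
    (hmax : ∀ v : Param d, ‖v‖ < r → f (a + v) ≤ f a) (v : Param d) :
    ∀ᶠ s : ℝ in 𝓝[>] 0, v.ofLp ⬝ᵥ g + s / 2 * quadForm Q v ≤ K * ‖v‖ ^ 3 * s ^ 2 := by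
  have hsmall : ∀ᶠ s : ℝ in 𝓝[>] 0, ‖s • v‖ < r := by
    refine nhdsWithin_le_nhds (ContinuousAt.eventually_lt (by fun_prop) (by fun_prop) ?_)
    simpa using hr
  filter_upwards [hsmall, self_mem_nhdsWithin] with s hs hs0
  have hs0 : 0 < s := hs0
  have hle := (abs_le.1 (hT _ hs)).1
  rw [quadForm_smul, WithLp.ofLp_smul, smul_dotProduct, smul_eq_mul, norm_smul,
    Real.norm_of_nonneg hs0.le, mul_pow] at hle
  refine le_of_mul_le_mul_left ?_ hs0
  linarith [hmax _ hs]

theorem TaylorBound.gradient_eq_zero_of_isMax (hr : 0 < r) (hT : TaylorBound r a f g Q K)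
    (hmax : ∀ v : Param d, ‖v‖ < r → f (a + v) ≤ f a) : g = 0 := by
  have hle : ∀ v : Param d, v.ofLp ⬝ᵥ g ≤ 0 := fun v => by
    have hlim : Tendsto (fun s => v.ofLp ⬝ᵥ g + s / 2 * quadForm Q v - K * ‖v‖ ^ 3 * s ^ 2)
        (𝓝[>] 0) (𝓝 (v.ofLp ⬝ᵥ g)) :=
      tendsto_nhdsWithin_of_tendsto_nhds <| Continuous.tendsto' (by fun_prop) _ _ (by simp)
    refine le_of_tendsto hlim ?_
    filter_upwards [hT.eventually_le_of_isMax hr hmax v] with s hs using sub_nonpos.2 hs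
  ext i
  have hi := hle (WithLp.toLp 2 (Pi.single i 1))
  have hi' := hle (-WithLp.toLp 2 (Pi.single i 1))
  rw [WithLp.ofLp_neg, neg_dotProduct] at hi'
  rw [single_one_dotProduct] at hi hi'
  exact le_antisymm hi (neg_nonpos.1 hi')

theorem TaylorBound.quadForm_nonpos_of_isMax (hr : 0 < r) (hT : TaylorBound r a f g Q K)
    (hmax : ∀ v : Param d, ‖v‖ < r → f (a + v) ≤ f a) (v : Param d) : quadForm Q v ≤ 0 := by
  refine ge_of_tendsto (x := 𝓝[>] (0 : ℝ)) (f := fun s => 2 * K * ‖v‖ ^ 3 * s)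
    (tendsto_nhdsWithin_of_tendsto_nhds <| Continuous.tendsto' (by fun_prop) _ _ (by simp)) ?_
  filter_upwards [hT.eventually_le_of_isMax hr hmax v, self_mem_nhdsWithin] with s hs hs0
  rw [hT.gradient_eq_zero_of_isMax hr hmax, dotProduct_zero] at hs
  refine le_of_mul_le_mul_left ?_ (mem_Ioi.1 hs0)
  linarith

theorem posDef_of_quadForm_nonneg (hsymm : Q.IsSymm) (hQ : ∀ v, 0 ≤ quadForm Q v)
    (hdet : Q.det ≠ 0) : Q.PosDef := by
  have hpsd : Q.PosSemidef := .of_dotProduct_mulVec_nonneg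
    (by rwa [Matrix.IsHermitian, Matrix.conjTranspose_eq_transpose_of_trivial])
    fun x => by simpa [quadForm] using hQ (WithLp.toLp 2 x)
  exact hpsd.posDef_iff_det_ne_zero.2 hdet

end TaylorBound

section Bregman

/-- The Bregman divergence of `φ`: the gap at `a` between `φ` and its tangent line at `b`. -/
def bregman (φ : ℝ → ℝ) (a b : ℝ) : ℝ := φ a - φ b - deriv φ b * (a - b)

variable {φ : ℝ → ℝ} {s : Set ℝ} {a b c : ℝ}

theorem bregman_pos (hφ : StrictConvexOn ℝ s φ) (hd : DifferentiableAt ℝ φ b) (ha : a ∈ s)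
    (hb : b ∈ s) (hab : a ≠ b) : 0 < bregman φ a b := by
  rw [bregman]
  rcases hab.lt_or_gt with h | h
  · have := hφ.slope_lt_deriv ha hb h hd
    rw [slope_def_field, div_lt_iff₀ (sub_pos.2 h)] at this
    linarith
  · have := hφ.deriv_lt_slope hb ha h hd
    rw [slope_def_field, lt_div_iff₀ (sub_pos.2 h)] at this
    linarith

theorem bregman_nonneg (hφ : StrictConvexOn ℝ s φ) (hd : DifferentiableAt ℝ φ b) (ha : a ∈ s)
    (hb : b ∈ s) : 0 ≤ bregman φ a b := by
  rcases eq_or_ne a b with rfl | h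
  · simp [bregman]
  · exact (bregman_pos hφ hd ha hb h).le

theorem bregman_le_bregman_of_mem_uIcc (hφ : StrictConvexOn ℝ s φ)
    (hd : ∀ x ∈ s, DifferentiableAt ℝ φ x) (hb : b ∈ s) (hc : c ∈ s) (h : b ∈ uIcc a c) :
    bregman φ a b ≤ bregman φ a c := by
  have hmono := hφ.convexOn.monotoneOn_deriv hd
  have hcross : 0 ≤ (deriv φ b - deriv φ c) * (a - b) := by
    rcases mem_uIcc.1 h with h | h
    · exact mul_nonneg_of_nonpos_of_nonpos (sub_nonpos.2 (hmono hb hc h.2)) (sub_nonpos.2 h.1)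
    · exact mul_nonneg (sub_nonneg.2 (hmono hc hb h.1)) (sub_nonneg.2 h.2)
  calc bregman φ a b
      ≤ bregman φ a b + bregman φ b c + (deriv φ b - deriv φ c) * (a - b) := by
        linarith [bregman_nonneg hφ (hd c hc) hb hc]
    _ = bregman φ a c := by simp only [bregman]; ring

theorem tendsto_of_tendsto_bregman (hφ : StrictConvexOn ℝ s φ)
    (hd : ∀ x ∈ s, DifferentiableAt ℝ φ x) (ha : s ∈ 𝓝 a) {ι : Type*} {l : Filter ι} {u : ι → ℝ}
    (hu : ∀ k, u k ∈ s) (h : Tendsto (fun k => bregman φ a (u k)) l (𝓝 0)) :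
    Tendsto u l (𝓝 a) := by
  have hfar : ∀ b ∈ s, b ≠ a → ∀ᶠ k in l, b ∉ uIcc a (u k) := fun b hb hba => by
    have hpos := bregman_pos hφ (hd b hb) (mem_of_mem_nhds ha) hb hba.symm
    filter_upwards [h.eventually_lt_const hpos] with k hk hmem
    exact hk.not_ge (bregman_le_bregman_of_mem_uIcc hφ hd hb (hu k) hmem)
  refine tendsto_order.2 ⟨fun c hc => ?_, fun c hc => ?_⟩
  · obtain ⟨b, hbs, hcb, hba⟩ := (Filter.Eventually.and (mem_nhdsWithin_of_mem_nhds ha)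
      (Ioo_mem_nhdsLT hc)).exists
    filter_upwards [hfar b hbs hba.ne] with k hk
    contrapose! hk
    exact mem_uIcc.2 (.inr ⟨hk.trans hcb.le, hba.le⟩)
  · obtain ⟨b, hbs, hab, hbc⟩ := (Filter.Eventually.and (mem_nhdsWithin_of_mem_nhds ha)
      (Ioo_mem_nhdsGT hc)).exists
    filter_upwards [hfar b hbs hab.ne'] with k hk
    contrapose! hk
    exact mem_uIcc.2 (.inl ⟨hab.le, hbc.le.trans hk⟩)

theorem IsDivergenceGenerator.differentiableAt (hφ : IsDivergenceGenerator φ) {u : ℝ}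
    (hu : u ∈ Ioi 0) : DifferentiableAt ℝ φ u :=
  (hφ.contDiffOn.differentiableOn (by norm_num)).differentiableAt (Ioi_mem_nhds hu)

theorem IsDivergenceGenerator.measurable_indicator (hφ : IsDivergenceGenerator φ) :
    Measurable ((Ioi (0 : ℝ)).indicator φ) := by
  classical
  rw [← piecewise_eq_indicator]
  exact hφ.contDiffOn.continuousOn.measurable_piecewise continuousOn_const measurableSet_Ioi

end Bregman

section Measurability

variable {d : ℕ} {𝒳 : Type*} [MeasurableSpace 𝒳] {φ ψ : ℝ → ℝ} {M : Model d 𝒳}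
  {θ α : Param d}

theorem Model.ratio_pos (hθ : θ ∈ M.Θ) (hα : α ∈ M.Θ) (x : 𝒳) : 0 < M.ratio θ α x :=
  div_pos (M.p_pos θ hθ x) (M.p_pos α hα x)

theorem Model.measurable_density (M : Model d 𝒳) (α : Param d) : Measurable (M.p α) :=
  M.measurable_p.comp measurable_prodMk_left

theorem Model.measurable_ratio (M : Model d 𝒳) (θ : Param d) :
    Measurable fun z : Param d × 𝒳 => M.ratio θ z.1 z.2 :=
  ((M.measurable_density θ).comp measurable_snd).div M.measurable_p

theorem measurable_dualIntegrand (φ : ℝ → ℝ) (M : Model d 𝒳) (θ : Param d) :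
    Measurable fun z : Param d × 𝒳 => dualIntegrand φ M θ z.1 z.2 :=
  ((measurable_deriv φ).comp (M.measurable_ratio θ)).mul
    ((M.measurable_density θ).comp measurable_snd)

theorem measurable_h (hφ : Measurable φ) (M : Model d 𝒳) (θ : Param d) :
    Measurable fun z : Param d × 𝒳 => h φ M θ z.1 z.2 := by
  have := M.sigmaFinite_dom
  have hmean : Measurable fun α : Param d => ∫ y, dualIntegrand φ M θ α y ∂M.dom :=
    (measurable_dualIntegrand φ M θ).stronglyMeasurable.integral_prod_right.measurable
  have hr := M.measurable_ratio θ
  exact (hmean.comp measurable_fst).sub ((hr.mul ((measurable_deriv φ).comp hr)).sub (hφ.comp hr))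

theorem measurable_divergence (hφ : Measurable φ) (M : Model d 𝒳) (θ : Param d) :
    Measurable (divergence φ M θ) := by
  have := M.sigmaFinite_dom
  have hr := M.measurable_ratio θ
  have heq : divergence φ M θ = fun α => ∫⁻ x, ENNReal.ofReal (M.p α x) *
      ENNReal.ofReal (φ (M.ratio θ α x)) ∂M.dom := funext fun α =>
    lintegral_withDensity_eq_lintegral_mul _ (M.measurable_density α).ennreal_ofReal
      (hφ.comp (hr.comp measurable_prodMk_left)).ennreal_ofReal
  rw [heq]
  exact Measurable.lintegral_prod_right
    (M.measurable_p.ennreal_ofReal.mul (hφ.comp hr).ennreal_ofReal)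

theorem measurableSet_finiteSet (hφ : Measurable φ) (M : Model d 𝒳) (θ : Param d) :
    MeasurableSet (finiteSet φ M θ) :=
  M.measurableSet_Θ.inter (measurableSet_lt (measurable_divergence hφ M θ) measurable_const)

theorem h_congr (hφψ : EqOn φ ψ (Ioi 0)) (hθ : θ ∈ M.Θ) (hα : α ∈ M.Θ) :
    h φ M θ α = h ψ M θ α := by
  have hderiv : ∀ x, deriv φ (M.ratio θ α x) = deriv ψ (M.ratio θ α x) := fun x =>
    (hφψ.eventuallyEq_of_mem (Ioi_mem_nhds (Model.ratio_pos hθ hα x))).deriv_eq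
  funext x
  simp only [h, dualIntegrand, hderiv, hφψ (Model.ratio_pos hθ hα x)]

theorem finiteSet_congr (hφψ : EqOn φ ψ (Ioi 0)) (hθ : θ ∈ M.Θ) :
    finiteSet φ M θ = finiteSet ψ M θ := by
  ext α
  refine and_congr_right fun hα => ?_
  simp only [divergence, hφψ (Model.ratio_pos hθ hα _)]

theorem Model.isProbabilityMeasure_law (hα : α ∈ M.Θ) : IsProbabilityMeasure (M.law α) :=
  ⟨by rw [Model.law, withDensity_apply _ MeasurableSet.univ, Measure.restrict_univ,
    M.lintegral_p α hα]⟩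

theorem Model.integrable_density (hα : α ∈ M.Θ) : Integrable (M.p α) M.dom := by
  refine ⟨(M.measurable_density α).aestronglyMeasurable, ?_⟩
  rw [hasFiniteIntegral_iff_ofReal (ae_of_all _ fun x => (M.p_pos α hα x).le),
    M.lintegral_p α hα]
  exact ENNReal.one_lt_top

theorem Model.integral_density (hα : α ∈ M.Θ) : ∫ x, M.p α x ∂M.dom = 1 := by
  rw [integral_eq_lintegral_of_nonneg_ae (ae_of_all _ fun x => (M.p_pos α hα x).le)
    (M.measurable_density α).aestronglyMeasurable, M.lintegral_p α hα, ENNReal.toReal_one]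

theorem Model.integral_law (hα : α ∈ M.Θ) (f : 𝒳 → ℝ) :
    ∫ x, f x ∂(M.law α) = ∫ x, M.p α x * f x ∂M.dom := by
  rw [Model.law, integral_withDensity_eq_integral_toReal_smul
    (M.measurable_density α).ennreal_ofReal (ae_of_all _ fun _ => ENNReal.ofReal_lt_top)]
  simp only [ENNReal.toReal_ofReal (M.p_pos α hα _).le, smul_eq_mul]

theorem Model.integrable_law_iff (hα : α ∈ M.Θ) {f : 𝒳 → ℝ} :
    Integrable f (M.law α) ↔ Integrable (fun x => M.p α x * f x) M.dom := by
  rw [Model.law, integrable_withDensity_iff_integrable_smul'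
    (M.measurable_density α).ennreal_ofReal (ae_of_all _ fun _ => ENNReal.ofReal_lt_top)]
  simp only [ENNReal.toReal_ofReal (M.p_pos α hα _).le, smul_eq_mul]

end Measurability

section Duality

variable {d : ℕ} {𝒳 : Type*} [MeasurableSpace 𝒳]

theorem tendsto_integral_abs_sub_of_tendsto_ae {ν : Measure 𝒳} {ι : Type*} {l : Filter ι}
    [l.IsCountablyGenerated] {f : ι → 𝒳 → ℝ} {g : 𝒳 → ℝ} (hf : ∀ k, Integrable (f k) ν)
    (hf0 : ∀ k x, 0 ≤ f k x) (hg : Integrable g ν) (heq : ∀ k, ∫ x, f k x ∂ν = ∫ x, g x ∂ν)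
    (hlim : ∀ᵐ x ∂ν, Tendsto (fun k => f k x) l (𝓝 (g x))) :
    Tendsto (fun k => ∫ x, |f k x - g x| ∂ν) l (𝓝 0) := by
  have hpos : ∀ k, Integrable (fun x => max (g x - f k x) 0) ν := fun k => (hg.sub (hf k)).pos_part
  -- Equal total masses make the positive and the negative part of `f k - g` equally heavy, and
  -- the negative one is dominated by `g`.
  have hsplit : ∀ k, ∫ x, |f k x - g x| ∂ν = 2 * ∫ x, max (g x - f k x) 0 ∂ν := fun k => by
    have habs : ∀ x, |f k x - g x| = f k x - g x + 2 * max (g x - f k x) 0 := fun x => by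
      rcases le_total (f k x) (g x) with h | h
      · rw [abs_of_nonpos (by linarith), max_eq_left (by linarith)]; ring
      · rw [abs_of_nonneg (by linarith), max_eq_right (by linarith)]; ring
    have hdiff : Integrable (fun x => f k x - g x) ν := (hf k).sub hg
    simp only [habs]
    rw [integral_add hdiff ((hpos k).const_mul 2), integral_sub (hf k) hg, heq, sub_self, zero_add,
      integral_const_mul]
  have hdom : Tendsto (fun k => ∫ x, max (g x - f k x) 0 ∂ν) l (𝓝 (∫ _x, (0 : ℝ) ∂ν)) := by
    refine tendsto_integral_filter_of_dominated_convergence (fun x => |g x|)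
      (.of_forall fun k => (hpos k).1) (.of_forall fun k => ae_of_all _ fun x => ?_) hg.abs ?_
    · rw [Real.norm_of_nonneg (le_max_right _ _)]
      exact max_le ((sub_le_self _ (hf0 k x)).trans (le_abs_self _)) (abs_nonneg _)
    · filter_upwards [hlim] with x hx
      simpa using (hx.const_sub (g x)).max (tendsto_const_nhds (x := (0 : ℝ)))
  simp_rw [hsplit]
  simpa using hdom.const_mul 2

theorem exists_seq_tendsto_ae_of_tendsto_integral {ν : Measure 𝒳} {g : ℕ → 𝒳 → ℝ}
    (hg : ∀ k, Integrable (g k) ν) (hg0 : ∀ k x, 0 ≤ g k x)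
    (hlim : Tendsto (fun k => ∫ x, g k x ∂ν) atTop (𝓝 0)) :
    ∃ ns : ℕ → ℕ, StrictMono ns ∧ ∀ᵐ x ∂ν, Tendsto (fun k => g (ns k) x) atTop (𝓝 0) := by
  have hnorm : ∀ k, eLpNorm (g k - 0) 1 ν = ENNReal.ofReal (∫ x, g k x ∂ν) := fun k => by
    rw [sub_zero, eLpNorm_one_eq_lintegral_enorm,
      ofReal_integral_eq_lintegral_ofReal (hg k) (ae_of_all _ (hg0 k))]
    exact lintegral_congr fun x => Real.enorm_of_nonneg (hg0 k x)
  refine (tendstoInMeasure_of_tendsto_eLpNorm (g := 0) one_ne_zero (fun k => (hg k).1)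
    aestronglyMeasurable_zero ?_).exists_seq_tendsto_ae
  simp_rw [hnorm]
  simpa using ENNReal.tendsto_ofReal hlim

variable {φ : ℝ → ℝ} {M : Model d 𝒳} {θ θ₀ α : Param d}

/-- The dominated density of `P_{θ₀} h(θ, α)`: the constant `∫ φ'(p_θ / p_α) p_θ dλ` of `h` is put
back under the integral sign. -/
def dualDensity (φ : ℝ → ℝ) (M : Model d 𝒳) (θ θ₀ α : Param d) (x : 𝒳) : ℝ :=
  dualIntegrand φ M θ α x -
    M.p θ₀ x * (M.ratio θ α x * deriv φ (M.ratio θ α x) - φ (M.ratio θ α x))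

theorem dualDensity_eq (φ : ℝ → ℝ) (M : Model d 𝒳) (θ θ₀ α : Param d) :
    dualDensity φ M θ θ₀ α = fun x => dualIntegrand φ M θ α x -
      M.p θ₀ x * (∫ y, dualIntegrand φ M θ α y ∂M.dom) + M.p θ₀ x * h φ M θ α x := by
  funext x
  rw [dualDensity, h]
  ring

theorem integrable_dualDensity (hθ₀ : θ₀ ∈ M.Θ) (hd : Integrable (dualIntegrand φ M θ α) M.dom)
    (hh : Integrable (h φ M θ α) (M.law θ₀)) : Integrable (dualDensity φ M θ θ₀ α) M.dom := by
  rw [dualDensity_eq]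
  exact (hd.sub ((Model.integrable_density hθ₀).mul_const _)).add
    ((Model.integrable_law_iff hθ₀).1 hh)

theorem integral_dualDensity (hθ₀ : θ₀ ∈ M.Θ) (hd : Integrable (dualIntegrand φ M θ α) M.dom)
    (hh : Integrable (h φ M θ α) (M.law θ₀)) :
    ∫ x, dualDensity φ M θ θ₀ α x ∂M.dom = ∫ x, h φ M θ α x ∂(M.law θ₀) := by
  have hconst := (Model.integrable_density hθ₀).mul_const (∫ y, dualIntegrand φ M θ α y ∂M.dom)
  have hdiff : Integrable (fun x => dualIntegrand φ M θ α x -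
      M.p θ₀ x * ∫ y, dualIntegrand φ M θ α y ∂M.dom) M.dom := hd.sub hconst
  rw [dualDensity_eq, integral_add hdiff ((Model.integrable_law_iff hθ₀).1 hh),
    integral_sub hd hconst, integral_mul_const, Model.integral_density hθ₀, one_mul, sub_self,
    zero_add, Model.integral_law hθ₀]

theorem density_mul_bregman_ratio (hθ₀ : θ₀ ∈ M.Θ) (x : 𝒳) :
    M.p θ₀ x * bregman φ (M.ratio θ θ₀ x) (M.ratio θ α x) =
      dualDensity φ M θ θ₀ θ₀ x - dualDensity φ M θ θ₀ α x := by
  have hp : M.p θ x = M.ratio θ θ₀ x * M.p θ₀ x := by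
    rw [Model.ratio, div_mul_cancel₀ _ (M.p_pos θ₀ hθ₀ x).ne']
  simp only [bregman, dualDensity, dualIntegrand, hp]
  ring

theorem integrable_density_mul_bregman_ratio (hθ₀ : θ₀ ∈ M.Θ)
    (hd : ∀ β ∈ ({θ₀, α} : Set (Param d)), Integrable (dualIntegrand φ M θ β) M.dom)
    (hh : ∀ β ∈ ({θ₀, α} : Set (Param d)), Integrable (h φ M θ β) (M.law θ₀)) :
    Integrable (fun x => M.p θ₀ x * bregman φ (M.ratio θ θ₀ x) (M.ratio θ α x)) M.dom := by
  simp only [density_mul_bregman_ratio hθ₀]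
  exact (integrable_dualDensity hθ₀ (hd θ₀ (.inl rfl)) (hh θ₀ (.inl rfl))).sub
    (integrable_dualDensity hθ₀ (hd α (.inr rfl)) (hh α (.inr rfl)))

theorem integral_density_mul_bregman_ratio (hθ₀ : θ₀ ∈ M.Θ)
    (hd : ∀ β ∈ ({θ₀, α} : Set (Param d)), Integrable (dualIntegrand φ M θ β) M.dom)
    (hh : ∀ β ∈ ({θ₀, α} : Set (Param d)), Integrable (h φ M θ β) (M.law θ₀)) :
    ∫ x, M.p θ₀ x * bregman φ (M.ratio θ θ₀ x) (M.ratio θ α x) ∂M.dom =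
      ∫ x, h φ M θ θ₀ x ∂(M.law θ₀) - ∫ x, h φ M θ α x ∂(M.law θ₀) := by
  have hd₀ := hd θ₀ (.inl rfl)
  have hh₀ := hh θ₀ (.inl rfl)
  have hdα := hd α (.inr rfl)
  have hhα := hh α (.inr rfl)
  simp only [density_mul_bregman_ratio hθ₀]
  rw [integral_sub (integrable_dualDensity hθ₀ hd₀ hh₀) (integrable_dualDensity hθ₀ hdα hhα),
    integral_dualDensity hθ₀ hd₀ hh₀, integral_dualDensity hθ₀ hdα hhα]

theorem density_mul_bregman_ratio_nonneg (hφ : IsDivergenceGenerator φ) (hθ : θ ∈ M.Θ)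
    (hθ₀ : θ₀ ∈ M.Θ) (hα : α ∈ M.Θ) (x : 𝒳) :
    0 ≤ M.p θ₀ x * bregman φ (M.ratio θ θ₀ x) (M.ratio θ α x) :=
  mul_nonneg (M.p_pos θ₀ hθ₀ x).le <| bregman_nonneg hφ.strictConvexOn
    (hφ.differentiableAt (Model.ratio_pos hθ hα x)) (Model.ratio_pos hθ hθ₀ x)
    (Model.ratio_pos hθ hα x)

theorem tendsto_density_of_tendsto_bregman_ratio (hφ : IsDivergenceGenerator φ) (hθ : θ ∈ M.Θ)
    (hθ₀ : θ₀ ∈ M.Θ) {ι : Type*} {l : Filter ι} {a : ι → Param d} (ha : ∀ k, a k ∈ M.Θ) {x : 𝒳}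
    (hlim : Tendsto (fun k => M.p θ₀ x * bregman φ (M.ratio θ θ₀ x) (M.ratio θ (a k) x)) l (𝓝 0)) :
    Tendsto (fun k => M.p (a k) x) l (𝓝 (M.p θ₀ x)) := by
  have hp := (M.p_pos θ hθ x).ne'
  have hp₀ := (M.p_pos θ₀ hθ₀ x).ne'
  have hbregman : Tendsto (fun k => bregman φ (M.ratio θ θ₀ x) (M.ratio θ (a k) x)) l (𝓝 0) := by
    simpa [hp₀] using hlim.const_mul (M.p θ₀ x)⁻¹
  have hratio := tendsto_of_tendsto_bregman hφ.strictConvexOn (fun _ hu => hφ.differentiableAt hu)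
    (Ioi_mem_nhds (Model.ratio_pos hθ hθ₀ x)) (fun k => Model.ratio_pos hθ (ha k) x) hbregman
  simpa [Model.ratio, Pi.div_def, div_div_cancel₀ hp] using
    (tendsto_const_nhds (x := M.p θ x)).div hratio (Model.ratio_pos hθ hθ₀ x).ne'

theorem isMaxOn_integral_h (hφ : IsDivergenceGenerator φ) (hθ : θ ∈ M.Θ)
    (hθ₀ : θ₀ ∈ finiteSet φ M θ)
    (hd : ∀ α ∈ finiteSet φ M θ, Integrable (dualIntegrand φ M θ α) M.dom)
    (hh : ∀ α ∈ finiteSet φ M θ, Integrable (h φ M θ α) (M.law θ₀)) :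
    IsMaxOn (fun α => ∫ x, h φ M θ α x ∂(M.law θ₀)) (finiteSet φ M θ) θ₀ := by
  refine isMaxOn_iff.2 fun α hα => ?_
  have hpair : {θ₀, α} ⊆ finiteSet φ M θ := pair_subset hθ₀ hα
  rw [← sub_nonneg, ← integral_density_mul_bregman_ratio hθ₀.1 (fun β hβ => hd β (hpair hβ))
    fun β hβ => hh β (hpair hβ)]
  exact integral_nonneg (density_mul_bregman_ratio_nonneg hφ hθ hθ₀.1 hα.1)

theorem exists_integral_h_le_sub (hφ : IsDivergenceGenerator φ) (hθ : θ ∈ M.Θ)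
    (hθ₀ : θ₀ ∈ finiteSet φ M θ)
    (hd : ∀ α ∈ finiteSet φ M θ, Integrable (dualIntegrand φ M θ α) M.dom)
    (hh : ∀ α ∈ finiteSet φ M θ, Integrable (h φ M θ α) (M.law θ₀))
    (hsep : SeparatedFrom φ M θ θ₀) {δ : ℝ} (hδ : 0 < δ) :
    ∃ κ : ℝ, 0 < κ ∧ ∀ α ∈ finiteSet φ M θ, δ ≤ ‖α - θ₀‖ →
      ∫ x, h φ M θ α x ∂(M.law θ₀) ≤ ∫ x, h φ M θ θ₀ x ∂(M.law θ₀) - κ := by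
  by_contra! hcon
  choose a ha hδa hlt using fun k : ℕ => hcon (1 / ((k : ℝ) + 1)) (by positivity)
  have hpair : ∀ k, {θ₀, a k} ⊆ finiteSet φ M θ := fun k => pair_subset hθ₀ (ha k)
  have hgap : Tendsto (fun k => ∫ x, M.p θ₀ x * bregman φ (M.ratio θ θ₀ x) (M.ratio θ (a k) x)
      ∂M.dom) atTop (𝓝 0) := by
    refine squeeze_zero (fun k => integral_nonneg <|
      density_mul_bregman_ratio_nonneg hφ hθ hθ₀.1 (ha k).1) (fun k => ?_)
      tendsto_one_div_add_atTop_nhds_zero_nat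
    rw [integral_density_mul_bregman_ratio hθ₀.1 (fun β hβ => hd β (hpair k hβ))
      fun β hβ => hh β (hpair k hβ)]
    linarith [hlt k]
  obtain ⟨ns, -, hns⟩ := exists_seq_tendsto_ae_of_tendsto_integral
    (fun k => integrable_density_mul_bregman_ratio hθ₀.1 (fun β hβ => hd β (hpair k hβ))
      fun β hβ => hh β (hpair k hβ))
    (fun k => density_mul_bregman_ratio_nonneg hφ hθ hθ₀.1 (ha k).1) hgap
  have hdist := tendsto_integral_abs_sub_of_tendsto_ae
    (fun k => Model.integrable_density (ha (ns k)).1) (fun k x => (M.p_pos _ (ha (ns k)).1 x).le)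
    (Model.integrable_density hθ₀.1)
    (fun k => by rw [Model.integral_density (ha (ns k)).1, Model.integral_density hθ₀.1])
    (hns.mono fun x hx =>
      tendsto_density_of_tendsto_bregman_ratio hφ hθ hθ₀.1 (fun k => (ha (ns k)).1) hx)
  obtain ⟨η, hη, hηle⟩ := hsep δ hδ
  obtain ⟨k, hk⟩ := (hdist.eventually_lt_const hη).exists
  exact hk.not_ge (hηle _ (ha (ns k)) (hδa (ns k)))

end Duality

section EmpiricalMean

variable {d : ℕ} {𝒳 Ω : Type*} {X : ℕ → Ω → 𝒳}

theorem empMean_eq_integral (X : ℕ → Ω → 𝒳) (n : ℕ) (ω : Ω) (f : 𝒳 → ℝ) :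
    empMean X n ω f = ∫ k : Fin n, f (X k ω) ∂((n : NNReal)⁻¹ • Measure.count) := by
  rw [integral_smul_nnreal_measure, integral_count, Fin.sum_univ_eq_sum_range fun k => f (X k ω)]
  rfl

theorem TaylorBound.empMean {F : Param d → 𝒳 → ℝ} {g : 𝒳 → Fin d → ℝ}
    {Q : 𝒳 → Matrix (Fin d) (Fin d) ℝ} {K : 𝒳 → ℝ} {r : ℝ} {a : Param d} {ω : Ω}
    (hT : ∀ k, TaylorBound r a (fun α => F α (X k ω)) (g (X k ω)) (Q (X k ω)) (K (X k ω)))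
    (n : ℕ) :
    TaylorBound r a (fun α => empMean X n ω (F α)) (fun i => empMean X n ω fun x => g x i)
      (Matrix.of fun i j => empMean X n ω fun x => Q x i j) (empMean X n ω K) := by
  simp only [empMean_eq_integral]
  exact TaylorBound.integral (F := fun α (k : Fin n) => F α (X k ω)) (fun _ _ => .of_finite)
    (fun _ => .of_finite) (fun _ _ => .of_finite) .of_finite (ae_of_all _ fun k => hT k)

variable [MeasurableSpace 𝒳] [MeasurableSpace Ω] {μ : Measure Ω} {ν : Measure 𝒳} {f : 𝒳 → ℝ}

theorem identDistrib_comp_of_map_eq {Y : Ω → 𝒳} (hY : Measurable Y) (hlaw : μ.map Y = ν)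
    (hf : AEMeasurable f ν) : IdentDistrib (f ∘ Y) f μ ν := by
  subst hlaw
  exact ⟨hf.comp_measurable hY, hf, AEMeasurable.map_map_of_aemeasurable hf hY.aemeasurable |>.symm⟩

theorem pairwise_indepFun_comp (hX : ∀ i, Measurable (X i))
    (hindep : Pairwise fun i j => X i ⟂ᵢ[μ] X j) (hlaw : ∀ i, μ.map (X i) = ν)
    (hf : AEMeasurable f ν) : Pairwise fun i j => (f ∘ X i) ⟂ᵢ[μ] (f ∘ X j) := fun i j hij =>
  (hindep hij).comp₀ (hX i).aemeasurable (hX j).aemeasurable (by rwa [hlaw i]) (by rwa [hlaw j])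

theorem tendsto_empMean (hX : ∀ i, Measurable (X i))
    (hindep : Pairwise fun i j => X i ⟂ᵢ[μ] X j) (hlaw : ∀ i, μ.map (X i) = ν)
    (hf : Integrable f ν) :
    ∀ᵐ ω ∂μ, Tendsto (fun n => empMean X n ω f) atTop (𝓝 (∫ x, f x ∂ν)) := by
  have hid := fun i => identDistrib_comp_of_map_eq (hX i) (hlaw i) hf.aemeasurable
  rw [← (hid 0).integral_eq]
  exact strong_law_ae (fun i => f ∘ X i) ((hid 0).integrable_iff.2 hf)
    (pairwise_indepFun_comp hX hindep hlaw hf.aemeasurable) fun i => (hid i).trans (hid 0).symm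

theorem memLp_empMean (hX : ∀ i, Measurable (X i)) (hlaw : ∀ i, μ.map (X i) = ν)
    (hf : MemLp f 2 ν) (n : ℕ) : MemLp (fun ω => empMean X n ω f) 2 μ :=
  (memLp_finsetSum _ fun i _ =>
    (identDistrib_comp_of_map_eq (hX i) (hlaw i) hf.aemeasurable).memLp_iff.2 hf).const_mul _

theorem integral_empMean (hX : ∀ i, Measurable (X i)) (hlaw : ∀ i, μ.map (X i) = ν)
    (hf : Integrable f ν) {n : ℕ} (hn : n ≠ 0) :
    ∫ ω, empMean X n ω f ∂μ = ∫ x, f x ∂ν := by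
  have hid := fun i => identDistrib_comp_of_map_eq (hX i) (hlaw i) hf.aemeasurable
  have hmean : ∀ i, ∫ ω, f (X i ω) ∂μ = ∫ x, f x ∂ν := fun i => (hid i).integral_eq
  simp only [empMean]
  rw [integral_const_mul, integral_finsetSum (f := fun i ω => f (X i ω)) _
    fun i _ => (hid i).integrable_iff.2 hf, Finset.sum_congr rfl fun i _ => hmean i]
  simp [hn]

theorem variance_empMean (hX : ∀ i, Measurable (X i))
    (hindep : Pairwise fun i j => X i ⟂ᵢ[μ] X j) (hlaw : ∀ i, μ.map (X i) = ν)
    (hf : MemLp f 2 ν) (n : ℕ) :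
    variance (fun ω => empMean X n ω f) μ = variance f ν / n := by
  have hid := fun i => identDistrib_comp_of_map_eq (hX i) (hlaw i) hf.aemeasurable
  have hsum : variance (∑ i ∈ Finset.range n, f ∘ X i) μ = n * variance f ν := by
    rw [IndepFun.variance_sum (fun i _ => (hid i).memLp_iff.2 hf)
      ((pairwise_indepFun_comp hX hindep hlaw hf.aemeasurable).set_pairwise _),
      Finset.sum_congr rfl fun i _ => (hid i).variance_eq, Finset.sum_const, Finset.card_range,
      nsmul_eq_mul]
  have heq : (fun ω => empMean X n ω f) =
      fun ω => (n : ℝ)⁻¹ * (∑ i ∈ Finset.range n, f ∘ X i) ω := by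
    ext ω
    simp [empMean]
  rw [heq, variance_const_mul, hsum]
  rcases eq_or_ne (n : ℝ) 0 with hn | hn
  · simp [hn]
  · field_simp

theorem measure_le_sqrt_mul_abs_empMean_sub [IsProbabilityMeasure μ] (hX : ∀ i, Measurable (X i))
    (hindep : Pairwise fun i j => X i ⟂ᵢ[μ] X j) (hlaw : ∀ i, μ.map (X i) = ν)
    (hf : MemLp f 2 ν) {c : ℝ} (hc : 0 < c) (n : ℕ) :
    μ {ω | c ≤ √n * |empMean X n ω f - ∫ x, f x ∂ν|} ≤ ENNReal.ofReal (variance f ν / c ^ 2) := by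
  rcases eq_or_ne n 0 with rfl | hn
  · simp [hc.not_ge]
  have : IsProbabilityMeasure ν :=
    hlaw 0 ▸ Measure.isProbabilityMeasure_map (hX 0).aemeasurable
  have hn0 : (0 : ℝ) < n := by positivity
  have hsqrt : 0 < √(n : ℝ) := Real.sqrt_pos.2 hn0
  have hcheb := meas_ge_le_variance_div_sq (memLp_empMean hX hlaw hf n) (div_pos hc hsqrt)
  rw [integral_empMean hX hlaw (hf.integrable one_le_two) hn, variance_empMean hX hindep hlaw hf,
    div_pow, Real.sq_sqrt hn0.le, div_div_div_cancel_right₀ hn0.ne'] at hcheb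
  simpa only [div_le_iff₀' hsqrt] using hcheb

end EmpiricalMean

section DominatedThirdPartials

variable {d : ℕ} {𝒳 : Type*} [MeasurableSpace 𝒳] {φ : ℝ → ℝ} {M : Model d 𝒳} {θ θ₀ : Param d}

/-- The part of the regularity condition `CondR2` that controls `h` itself: near `θ₀` the partial
derivatives of `h` up to order three exist, those of order three being dominated. -/
def HasDominatedThirdPartials (φ : ℝ → ℝ) (M : Model d 𝒳) (θ θ₀ : Param d) : Prop :=
  ∃ N : Set (Param d), IsOpen N ∧ θ₀ ∈ N ∧ N ⊆ finiteSet φ M θ ∧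
    ∃ H : 𝒳 → ℝ, Integrable H (M.law θ₀) ∧ ∀ᵐ x ∂(M.law θ₀),
      HasBoundedThirdPartialsOn (fun α => h φ M θ α x) N (H x)

theorem CondR2.hasDominatedThirdPartials (hR2 : CondR2 φ M θ θ₀) :
    HasDominatedThirdPartials φ M θ θ₀ := by
  obtain ⟨N, hN, hθ₀, hsub, -, H, hH, hae⟩ := hR2
  exact ⟨N, hN, hθ₀, hsub, H, hH, hae.mono fun x hx => ⟨hx.1, hx.2⟩⟩

namespace HasDominatedThirdPartials

theorem finiteSet_mem_nhds (hR2 : HasDominatedThirdPartials φ M θ θ₀) :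
    finiteSet φ M θ ∈ 𝓝 θ₀ := by
  obtain ⟨N, hN, hθ₀, hsub, -⟩ := hR2
  exact mem_of_superset (hN.mem_nhds hθ₀) hsub

theorem mem_finiteSet (hR2 : HasDominatedThirdPartials φ M θ θ₀) : θ₀ ∈ finiteSet φ M θ :=
  mem_of_mem_nhds hR2.finiteSet_mem_nhds

theorem isSymm_hessH (hR2 : HasDominatedThirdPartials φ M θ θ₀) :
    ∀ᵐ x ∂(M.law θ₀), (hessH φ M θ θ₀ x).IsSymm := by
  obtain ⟨N, hN, hθ₀, -, H, -, hae⟩ := hR2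
  exact hae.mono fun x hx => hx.isSymm_pdMat (hN.mem_nhds hθ₀)

theorem exists_taylorBound (hR2 : HasDominatedThirdPartials φ M θ θ₀) :
    ∃ r : ℝ, 0 < r ∧ (∀ v : Param d, ‖v‖ < r → θ₀ + v ∈ finiteSet φ M θ) ∧
      ∃ K : 𝒳 → ℝ, Integrable K (M.law θ₀) ∧ ∀ᵐ x ∂(M.law θ₀),
        TaylorBound r θ₀ (fun α => h φ M θ α x) (gradH φ M θ θ₀ x) (hessH φ M θ θ₀ x) (K x) := by
  obtain ⟨N, hN, hθ₀, hsub, H, hH, hae⟩ := hR2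
  obtain ⟨r, hr, hball⟩ := Metric.isOpen_iff.1 hN θ₀ hθ₀
  refine ⟨r, hr, fun v hv => hsub (hball (by simpa using hv)), fun x => d ^ 3 * H x,
    hH.const_mul _, hae.mono fun x hx => (hx.mono hball).taylorBound⟩

end HasDominatedThirdPartials

end DominatedThirdPartials

section L1Convergence

variable {E ι : Type*} [MeasurableSpace E] {μ : Measure E} {l : Filter ι}

theorem tendsto_lintegral_enorm_sub_of_dominated [l.IsCountablyGenerated] {F : ι → E → ℝ}
    {G bound : E → ℝ} (hF : ∀ᶠ n in l, AEStronglyMeasurable (F n) μ) (hG : Integrable G μ)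
    (hbound : Integrable bound μ) (hle : ∀ᶠ n in l, ∀ t, |F n t| ≤ bound t)
    (hlim : ∀ t, Tendsto (fun n => F n t) l (𝓝 (G t))) :
    Tendsto (fun n => ∫⁻ t, ‖F n t - G t‖ₑ ∂μ) l (𝓝 0) := by
  rw [← lintegral_zero (μ := μ)]
  refine tendsto_lintegral_filter_of_dominated_convergence' (fun t => ‖bound t‖ₑ + ‖G t‖ₑ)
    (hF.mono fun n hn => (hn.sub hG.1).enorm) ?_ ?_ (ae_of_all _ fun t => ?_)
  · filter_upwards [hle] with n hn
    refine ae_of_all _ fun t => enorm_sub_le.trans (add_le_add_left ?_ _)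
    rw [enorm_le_iff_norm_le]
    exact (hn t).trans (le_abs_self _)
  · rw [lintegral_add_left' hbound.1.enorm]
    exact ENNReal.add_ne_top.2 ⟨hbound.2.ne, hG.2.ne⟩
  · simpa using ((hlim t).sub_const (G t)).enorm

theorem tendsto_lintegral_enorm_div_integral_sub {W : ι → E → ℝ} {G : E → ℝ}
    (hW : ∀ᶠ n in l, AEStronglyMeasurable (W n) μ) (hG : Integrable G μ) (hG0 : ∫ t, G t ∂μ ≠ 0)
    (hlim : Tendsto (fun n => ∫⁻ t, ‖W n t - G t‖ₑ ∂μ) l (𝓝 0)) :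
    Tendsto (fun n => ∫⁻ t, ‖W n t / (∫ s, W n s ∂μ) - G t / (∫ s, G s ∂μ)‖ₑ ∂μ) l (𝓝 0) := by
  have hWi : ∀ᶠ n in l, Integrable (W n) μ := by
    filter_upwards [hW, hlim.eventually_lt_const ENNReal.zero_lt_top] with n hn hfin
    have hdiff : Integrable (fun t => W n t - G t) μ := ⟨hn.sub hG.1, hfin⟩
    exact (hdiff.add hG).congr (ae_of_all _ fun t => sub_add_cancel _ _)
  have hinv := (tendsto_integral_of_L1 G hG.1 hWi hlim).inv₀ hG0
  set I := ∫ t, G t ∂μ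
  have hfirst : Tendsto (fun n => ‖(∫ t, W n t ∂μ)⁻¹‖ₑ * ∫⁻ t, ‖W n t - G t‖ₑ ∂μ) l (𝓝 0) := by
    simpa using ENNReal.Tendsto.mul hinv.enorm (Or.inr ENNReal.zero_ne_top) hlim
      (Or.inr enorm_ne_top)
  have hsecond : Tendsto (fun n => ‖(∫ t, W n t ∂μ)⁻¹ - I⁻¹‖ₑ * ∫⁻ t, ‖G t‖ₑ ∂μ) l (𝓝 0) := by
    simpa using ENNReal.Tendsto.mul_const (hinv.sub_const I⁻¹).enorm (Or.inr hG.2.ne)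
  refine tendsto_of_tendsto_of_tendsto_of_le_of_le' tendsto_const_nhds
    (by simpa using hfirst.add hsecond) (Eventually.of_forall fun _ => zero_le) ?_
  filter_upwards [hW] with n hn
  have hm : AEMeasurable (fun t => ‖W n t - G t‖ₑ) μ := (hn.sub hG.1).enorm
  rw [← lintegral_const_mul'' _ hm, ← lintegral_const_mul'' _ hG.1.enorm,
    ← lintegral_add_left' (hm.const_mul _)]
  refine lintegral_mono fun t => ?_
  rw [← enorm_mul, ← enorm_mul]
  refine le_trans (le_of_eq ?_) (enorm_add_le _ _)
  congr 1
  ring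

end L1Convergence

section ChangeOfVariables

variable {E : Type*} [NormedAddCommGroup E] [NormedSpace ℝ E] [MeasurableSpace E] [BorelSpace E]
  {s : ℝ}

theorem measurableEmbedding_inv_smul_add (hs : 0 < s) (b : E) :
    MeasurableEmbedding fun t : E => s⁻¹ • t + b :=
  ((Homeomorph.smulOfNeZero s⁻¹ (inv_pos.2 hs).ne').trans
    (Homeomorph.addRight b)).measurableEmbedding

variable [FiniteDimensional ℝ E] (μ : Measure E) [μ.IsAddHaarMeasure]

theorem map_inv_smul_add (hs : 0 < s) (b : E) :
    μ.map (fun t => s⁻¹ • t + b) = ENNReal.ofReal (s ^ Module.finrank ℝ E) • μ := by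
  have hcomp : (fun t : E => s⁻¹ • t + b) = (· + b) ∘ (s⁻¹ • ·) := rfl
  rw [hcomp, ← Measure.map_map (by fun_prop) (by fun_prop),
    Measure.map_addHaar_smul μ (inv_pos.2 hs).ne', Measure.map_smul, map_add_right_eq_self,
    inv_pow, inv_inv, abs_of_pos (by positivity)]

theorem quasiMeasurePreserving_inv_smul_add (hs : 0 < s) (b : E) :
    Measure.QuasiMeasurePreserving (fun t => s⁻¹ • t + b) μ μ :=
  ⟨by fun_prop, by rw [map_inv_smul_add μ hs]; exact Measure.smul_absolutelyContinuous⟩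

theorem lintegral_comp_inv_smul_add (f : E → ℝ≥0∞) (hs : 0 < s) (b : E) :
    ∫⁻ t, f (s⁻¹ • t + b) ∂μ = ENNReal.ofReal (s ^ Module.finrank ℝ E) * ∫⁻ t, f t ∂μ := by
  rw [← (measurableEmbedding_inv_smul_add hs b).lintegral_map, map_inv_smul_add μ hs,
    lintegral_smul_measure, smul_eq_mul]

theorem integral_comp_inv_smul_add (f : E → ℝ) (hs : 0 < s) (b : E) :
    ∫ t, f (s⁻¹ • t + b) ∂μ = s ^ Module.finrank ℝ E * ∫ t, f t ∂μ := by
  rw [← (measurableEmbedding_inv_smul_add hs b).integral_map, map_inv_smul_add μ hs,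
    integral_smul_measure, ENNReal.toReal_ofReal (by positivity), smul_eq_mul]

end ChangeOfVariables

section Laplace

variable {d : ℕ} {S : Matrix (Fin d) (Fin d) ℝ} {U : Set (Param d)} {prior : Param d → ℝ}
  {a : Param d}

/-- The remainder at `a + v` of the expansion of `f` around `a` with gradient `g` and second-order
form `-S`; the `R_n` of the theorem is the instance `f = P_n h(θ, ·)`, `a = θ₀`, `g = U_n(θ₀)`. -/
def quadRemainder (S : Matrix (Fin d) (Fin d) ℝ) (a : Param d) (f : Param d → ℝ) (g : Fin d → ℝ)
    (v : Param d) : ℝ :=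
  f (a + v) - f a - v.ofLp ⬝ᵥ g + 1 / 2 * quadForm S v

/-- Along `l`, the functions `L n` have at `a` a second-order expansion with gradients `g n` and
common second-order form `-S`, the remainder being `o(‖v‖ ^ 2)` uniformly in `n`. -/
def IsLocallyQuadratic (S : Matrix (Fin d) (Fin d) ℝ) (a : Param d) (l : Filter ℕ)
    (L : ℕ → Param d → ℝ) (g : ℕ → Fin d → ℝ) : Prop :=
  ∀ c : ℝ, 0 < c → ∃ δ : ℝ, 0 < δ ∧ ∀ᶠ n in l, ∀ v : Param d, ‖v‖ < δ →
    |quadRemainder S a (L n) (g n) v| ≤ c * ‖v‖ ^ 2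

/-- Along `l`, the point `a` is a well-separated maximizer of the `L n` over `U`: outside any
neighbourhood of `a`, the functions stay below their values at `a` by a gap uniform in `n`. -/
def IsWellSeparatedMax (U : Set (Param d)) (a : Param d) (l : Filter ℕ)
    (L : ℕ → Param d → ℝ) : Prop :=
  ∀ δ : ℝ, 0 < δ → ∃ κ : ℝ, 0 < κ ∧
    ∀ᶠ n in l, ∀ α ∈ U, δ ≤ ‖α - a‖ → L n α ≤ L n a - κ

/-- The weight `exp(n L(α)) π(α)`, carried by `U`, in the local coordinate `t = √n (α - a - w)`. The
constant factor makes it converge to `π(a) exp(-tᵀ S t / 2)`. -/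
def localWeight (S : Matrix (Fin d) (Fin d) ℝ) (U : Set (Param d)) (prior : Param d → ℝ)
    (a : Param d) (L : Param d → ℝ) (w : Param d) (n : ℕ) (t : Param d) : ℝ :=
  U.indicator (fun α => Real.exp (n * (L α - L a - 1 / 2 * quadForm S w)) * prior α)
    ((√n)⁻¹ • t + (a + w))

theorem TaylorBound.abs_quadRemainder_le {r K : ℝ} {f : Param d → ℝ} {g : Fin d → ℝ}
    {Q : Matrix (Fin d) (Fin d) ℝ} (hT : TaylorBound r a f g Q K) {v : Param d} (hv : ‖v‖ < r) :
    |quadRemainder S a f g v| ≤ (K * ‖v‖ + (∑ i, ∑ j, |(Q + S) i j|) / 2) * ‖v‖ ^ 2 := by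
  have hquad := abs_quadForm_le (Q + S) v
  calc |quadRemainder S a f g v|
      = |(f (a + v) - f a - v.ofLp ⬝ᵥ g - 1 / 2 * quadForm Q v)
          + 1 / 2 * quadForm (Q + S) v| := by
        rw [quadRemainder, quadForm_add_matrix]
        ring_nf
    _ ≤ K * ‖v‖ ^ 3 + 1 / 2 * ((∑ i, ∑ j, |(Q + S) i j|) * ‖v‖ ^ 2) := by
        refine (abs_add_le _ _).trans (add_le_add (hT v hv) ?_)
        rw [abs_mul, abs_of_pos one_half_pos]
        gcongr
    _ = _ := by ring

variable {l : Filter ℕ} {L : ℕ → Param d → ℝ}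

theorem IsLocallyQuadratic.mono {l' : Filter ℕ} {g : ℕ → Fin d → ℝ}
    (hL : IsLocallyQuadratic S a l L g) (hl : l' ≤ l) : IsLocallyQuadratic S a l' L g :=
  fun c hc => (hL c hc).imp fun _ hδ => ⟨hδ.1, hl hδ.2⟩

theorem IsWellSeparatedMax.mono {l' : Filter ℕ} (hL : IsWellSeparatedMax U a l L) (hl : l' ≤ l) :
    IsWellSeparatedMax U a l' L :=
  fun δ hδ => (hL δ hδ).imp fun _ hκ => ⟨hκ.1, hl hκ.2⟩

theorem IsWellSeparatedMax.of_tendsto_iSup {L' : ℕ → Param d → ℝ}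
    (hL : IsWellSeparatedMax U a l L) (ha : a ∈ U)
    (hlim : Tendsto (fun n => ⨆ α ∈ U, ‖L' n α - L n α‖ₑ) l (𝓝 0)) :
    IsWellSeparatedMax U a l L' := by
  intro δ hδ
  obtain ⟨κ, hκ, hgap⟩ := hL δ hδ
  refine ⟨κ / 2, half_pos hκ, ?_⟩
  have hκ4 : 0 < ENNReal.ofReal (κ / 4) := ENNReal.ofReal_pos.2 (by positivity)
  filter_upwards [hgap, hlim.eventually_lt_const hκ4] with n hgapn hn α hα hαδ
  have hclose : ∀ β ∈ U, |L' n β - L n β| < κ / 4 := by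
    intro β hβ
    have hlt := (le_iSup₂ (f := fun β (_ : β ∈ U) => ‖L' n β - L n β‖ₑ) β hβ).trans_lt hn
    rwa [← ofReal_norm, ENNReal.ofReal_lt_ofReal_iff (by positivity)] at hlt
  linarith [hgapn α hα hαδ, (abs_lt.1 (hclose α hα)).2, (abs_lt.1 (hclose a ha)).1]

theorem isLocallyQuadratic_of_taylorBound {r K₀ : ℝ} {g : ℕ → Fin d → ℝ}
    {Q : ℕ → Matrix (Fin d) (Fin d) ℝ} {K : ℕ → ℝ} (hr : 0 < r)
    (hT : ∀ n, TaylorBound r a (L n) (g n) (Q n) (K n))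
    (hQ : ∀ i j, Tendsto (fun n => Q n i j) l (𝓝 (-S i j))) (hK : Tendsto K l (𝓝 K₀)) :
    IsLocallyQuadratic S a l L g := by
  intro c hc
  have hQ0 : Tendsto (fun n => (∑ i, ∑ j, |(Q n + S) i j|) / 2) l (𝓝 0) := by
    have hlim := (tendsto_finsetSum Finset.univ fun i _ => tendsto_finsetSum Finset.univ
      fun j _ => ((hQ i j).add_const (S i j)).abs).div_const 2
    simpa using hlim
  set A := |K₀| + 1
  have hA : 0 < A := by positivity
  have hK₀A : K₀ < A := (le_abs_self K₀).trans_lt (lt_add_one _)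
  refine ⟨min r (c / 2 / A), by positivity, ?_⟩
  filter_upwards [hK.eventually_lt_const hK₀A, hQ0.eventually_lt_const (half_pos hc)]
    with n hKn hQn v hv
  refine ((hT n).abs_quadRemainder_le (hv.trans_le (min_le_left _ _))).trans ?_
  have hKv : K n * ‖v‖ ≤ c / 2 := by
    calc K n * ‖v‖ ≤ A * (c / 2 / A) := by
          gcongr
          exact hv.le.trans (min_le_right _ _)
      _ = c / 2 := mul_div_cancel₀ _ hA.ne'
  gcongr
  linarith

theorem localWeight_eq (hS : S.IsSymm) {L : Param d → ℝ} {w t : Param d} {n : ℕ} (hn : n ≠ 0)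
    (hU : a + ((√n)⁻¹ • t + w) ∈ U) :
    localWeight S U prior a L w n t = Real.exp (-(1 / 2) * quadForm S t +
      n * quadRemainder S a L (S *ᵥ w.ofLp) ((√n)⁻¹ • t + w)) *
      prior (a + ((√n)⁻¹ • t + w)) := by
  set v := (√n)⁻¹ • t + w with hv
  have hsub : v - w = (√n)⁻¹ • t := add_sub_cancel_right _ _
  have hquad : n * quadForm S (v - w) = quadForm S t := by
    rw [hsub, quadForm_smul, inv_pow, Real.sq_sqrt n.cast_nonneg, mul_inv_cancel_left₀]
    exact_mod_cast hn
  rw [localWeight, add_left_comm, ← hv, indicator_of_mem hU, ← hquad, quadForm_sub hS,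
    quadRemainder]
  ring_nf

theorem localWeight_of_notMem {L : Param d → ℝ} {w t : Param d} {n : ℕ}
    (hU : a + ((√n)⁻¹ • t + w) ∉ U) : localWeight S U prior a L w n t = 0 := by
  rw [localWeight, add_left_comm, indicator_of_notMem hU]

theorem localWeight_div_integral (hU : MeasurableSet U) (L : Param d → ℝ) (w : Param d) {n : ℕ}
    (hn : n ≠ 0) (t : Param d) :
    localWeight S U prior a L w n t / (∫ s, localWeight S U prior a L w n s) =
      (√n ^ d)⁻¹ * (U.indicator (fun α => Real.exp (n * L α) * prior α)
        ((√n)⁻¹ • t + (a + w)) / ∫ β in U, Real.exp (n * L β) * prior β) := by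
  set c := Real.exp (-(n * (L a + 1 / 2 * quadForm S w)))
  set u := U.indicator fun α => Real.exp (n * L α) * prior α
  have hfactor : ∀ s, localWeight S U prior a L w n s = c * u ((√n)⁻¹ • s + (a + w)) := by
    intro s
    rw [localWeight, ← indicator_const_mul]
    refine congrFun (congrArg (indicator U) (funext fun α => ?_)) _
    rw [← mul_assoc, ← Real.exp_add]
    ring_nf
  simp only [hfactor]
  rw [integral_const_mul, integral_comp_inv_smul_add volume u (Real.sqrt_pos.2 (by positivity)),
    finrank_euclideanSpace_fin, integral_indicator hU, mul_div_mul_left _ _ (Real.exp_ne_zero _),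
    div_mul_eq_div_div_swap, inv_mul_eq_div]

theorem aestronglyMeasurable_localWeight (hU : MeasurableSet U)
    (hprior : AEStronglyMeasurable prior (volume.restrict U)) {L : Param d → ℝ}
    (hL : AEStronglyMeasurable L (volume.restrict U)) (w : Param d) {n : ℕ} (hn : n ≠ 0) :
    AEStronglyMeasurable (localWeight S U prior a L w n) := by
  have hweight : AEStronglyMeasurable
      (U.indicator fun α => Real.exp (n * (L α - L a - 1 / 2 * quadForm S w)) * prior α) := by
    rw [aestronglyMeasurable_indicator_iff hU]
    exact (Real.continuous_exp.comp_aestronglyMeasurable (((hL.sub aestronglyMeasurable_const).sub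
      aestronglyMeasurable_const).const_mul _)).mul hprior
  exact hweight.comp_quasiMeasurePreserving
    (quasiMeasurePreserving_inv_smul_add _ (Real.sqrt_pos.2 (by positivity)) _)

section LocalCoordinate

variable {w t : Param d} {n : ℕ} {B : ℝ}

theorem mul_norm_inv_sqrt_smul_add_sq_le (hn : n ≠ 0) (hw : √n * ‖w‖ ≤ B) :
    n * ‖(√n)⁻¹ • t + w‖ ^ 2 ≤ 2 * (B ^ 2 + ‖t‖ ^ 2) := by
  have hs : 0 < √(n : ℝ) := Real.sqrt_pos.2 (by positivity)
  have hnorm : √n * ‖(√n)⁻¹ • t + w‖ ≤ B + ‖t‖ := by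
    calc √n * ‖(√n)⁻¹ • t + w‖ ≤ √n * ((√n)⁻¹ * ‖t‖ + ‖w‖) := by
          gcongr
          refine (norm_add_le _ _).trans_eq ?_
          rw [norm_smul, norm_inv, Real.norm_of_nonneg hs.le]
      _ = ‖t‖ + √n * ‖w‖ := by rw [mul_add, mul_inv_cancel_left₀ hs.ne']
      _ ≤ B + ‖t‖ := by linarith
  calc n * ‖(√n)⁻¹ • t + w‖ ^ 2 = (√n * ‖(√n)⁻¹ • t + w‖) ^ 2 := by
        rw [mul_pow, Real.sq_sqrt n.cast_nonneg]
    _ ≤ (B + ‖t‖) ^ 2 := by gcongr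
    _ ≤ 2 * (B ^ 2 + ‖t‖ ^ 2) := add_sq_le

theorem mul_abs_le_of_abs_le_mul_norm_sq (hn : n ≠ 0) (hw : √n * ‖w‖ ≤ B) {c R : ℝ} (hc : 0 ≤ c)
    (hR : |R| ≤ c * ‖(√n)⁻¹ • t + w‖ ^ 2) : |n * R| ≤ c * (2 * (B ^ 2 + ‖t‖ ^ 2)) := by
  calc |n * R| ≤ n * (c * ‖(√n)⁻¹ • t + w‖ ^ 2) := by
        rw [abs_mul, Nat.abs_cast]
        gcongr
    _ = c * (n * ‖(√n)⁻¹ • t + w‖ ^ 2) := by ring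
    _ ≤ c * (2 * (B ^ 2 + ‖t‖ ^ 2)) :=
        mul_le_mul_of_nonneg_left (mul_norm_inv_sqrt_smul_add_sq_le hn hw) hc

end LocalCoordinate

variable {w : ℕ → Param d} {B : ℝ}

theorem tendsto_inv_sqrt_smul_add (hl : l ≤ atTop) (hw : ∀ᶠ n : ℕ in l, √n * ‖w n‖ ≤ B)
    (t : Param d) : Tendsto (fun n : ℕ => (√n)⁻¹ • t + w n) l (𝓝 0) := by
  have hinv : Tendsto (fun n : ℕ => (√(n : ℝ))⁻¹) l (𝓝 0) :=
    ((Real.tendsto_sqrt_atTop.comp tendsto_natCast_atTop_atTop).mono_left hl).inv_tendsto_atTop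
  have hw0 : Tendsto w l (𝓝 0) := by
    refine squeeze_zero_norm' ?_ (by simpa using hinv.mul_const B)
    filter_upwards [hw, hl (eventually_ne_atTop 0)] with n hwn hn
    exact (le_inv_mul_iff₀ (Real.sqrt_pos.2 (by positivity))).2 hwn
  simpa using (hinv.smul_const t).add hw0

theorem tendsto_mul_quadRemainder (hl : l ≤ atTop) (hw : ∀ᶠ n : ℕ in l, √n * ‖w n‖ ≤ B)
    {g : ℕ → Fin d → ℝ} (hL : IsLocallyQuadratic S a l L g) (t : Param d) :
    Tendsto (fun n : ℕ => n * quadRemainder S a (L n) (g n) ((√n)⁻¹ • t + w n)) l (𝓝 0) := by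
  rw [Metric.tendsto_nhds]
  intro ε hε
  obtain ⟨δ, hδ, hquad⟩ := hL (ε / (4 * (B ^ 2 + ‖t‖ ^ 2 + 1))) (by positivity)
  have hsmall := (tendsto_inv_sqrt_smul_add hl hw t).norm.eventually_lt_const
    (norm_zero.trans_lt hδ)
  filter_upwards [hw, hl (eventually_ne_atTop 0), hquad, hsmall] with n hwn hn hqn hvn
  rw [dist_zero_right, Real.norm_eq_abs]
  refine (mul_abs_le_of_abs_le_mul_norm_sq hn hwn (by positivity) (hqn _ hvn)).trans_lt ?_
  rw [div_mul_eq_mul_div, div_lt_iff₀ (by positivity)]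
  nlinarith [sq_nonneg B, sq_nonneg ‖t‖]

theorem tendsto_localWeight (hl : l ≤ atTop) (hS : S.IsSymm) (hU : U ∈ 𝓝 a)
    (hprior : ContinuousAt prior a) (hw : ∀ᶠ n : ℕ in l, √n * ‖w n‖ ≤ B)
    (hL : IsLocallyQuadratic S a l L fun n => S *ᵥ (w n).ofLp) (t : Param d) :
    Tendsto (fun n : ℕ => localWeight S U prior a (L n) (w n) n t) l
      (𝓝 (Real.exp (-(1 / 2) * quadForm S t) * prior a)) := by
  have hpoint : Tendsto (fun n : ℕ => a + ((√n)⁻¹ • t + w n)) l (𝓝 a) := by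
    simpa using (tendsto_inv_sqrt_smul_add hl hw t).const_add a
  have hexp := ((tendsto_mul_quadRemainder hl hw hL t).const_add (-(1 / 2) * quadForm S t)).rexp
  rw [add_zero] at hexp
  refine (hexp.mul (hprior.tendsto.comp hpoint)).congr' ?_
  filter_upwards [hl (eventually_ne_atTop 0), hpoint hU] with n hn hUn
  exact (localWeight_eq hS hn hUn).symm

-- Halving the exponent `-tᵀ S t / 2` leaves room for the remainder.
theorem exists_abs_localWeight_le (hl : l ≤ atTop) (hS : S.PosDef)
    (hprior : ContinuousAt prior a) (hw : ∀ᶠ n : ℕ in l, √n * ‖w n‖ ≤ B)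
    (hL : IsLocallyQuadratic S a l L fun n => S *ᵥ (w n).ofLp) :
    ∃ δ A : ℝ, 0 < δ ∧ 0 ≤ A ∧ ∀ᶠ n : ℕ in l, ∀ t : Param d, ‖(√n)⁻¹ • t + w n‖ < δ →
      |localWeight S U prior a (L n) (w n) n t| ≤
        A * Real.exp (-(1 / 2) * quadForm ((1 / 2 : ℝ) • S) t) := by
  obtain ⟨c, hc, hcoer⟩ := exists_mul_norm_sq_le_quadForm hS
  obtain ⟨δ₁, hδ₁, hbound⟩ := Metric.eventually_nhds_iff.1
    (hprior.abs.eventually_lt_const (lt_add_one |prior a|))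
  obtain ⟨δ₂, hδ₂, hquad⟩ := hL (c / 8) (by positivity)
  refine ⟨min δ₁ δ₂, (|prior a| + 1) * Real.exp (c / 4 * B ^ 2), by positivity, by positivity, ?_⟩
  filter_upwards [hw, hl (eventually_ne_atTop 0), hquad] with n hwn hn hqn t ht
  by_cases hUt : a + ((√n)⁻¹ • t + w n) ∈ U
  · have hrem := (le_abs_self _).trans <| mul_abs_le_of_abs_le_mul_norm_sq hn hwn (by positivity)
      (hqn _ (ht.trans_le (min_le_right _ _)))
    have hpr : |prior (a + ((√n)⁻¹ • t + w n))| ≤ |prior a| + 1 :=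
      (hbound (by simpa [dist_eq_norm] using ht.trans_le (min_le_left _ _))).le
    have hhalf : quadForm ((1 / 2 : ℝ) • S) t = 1 / 2 * quadForm S t := by
      rw [quadForm, quadForm, Matrix.smul_mulVec, dotProduct_smul, smul_eq_mul]
    rw [localWeight_eq (Matrix.isHermitian_iff_isSymm.1 hS.isHermitian) hn hUt, abs_mul,
      Real.abs_exp, mul_comm, mul_assoc, ← Real.exp_add, hhalf]
    refine mul_le_mul hpr (Real.exp_le_exp.2 ?_) (Real.exp_pos _).le (by positivity)
    linarith [hcoer t]
  · rw [localWeight_of_notMem hUt, abs_zero]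
    positivity

end Laplace

section LaplaceLimit

variable {d : ℕ} {S : Matrix (Fin d) (Fin d) ℝ} {U : Set (Param d)} {prior : Param d → ℝ}
  {a : Param d} {l : Filter ℕ} {L : ℕ → Param d → ℝ} {w : ℕ → Param d} {B : ℝ}

theorem exists_tendsto_lintegral_indicator_localWeight_sub [l.IsCountablyGenerated]
    (hl : l ≤ atTop) (hS : S.PosDef) (hUm : MeasurableSet U) (hU : U ∈ 𝓝 a)
    (hprior : AEStronglyMeasurable prior (volume.restrict U)) (hcont : ContinuousAt prior a)
    (hLm : ∀ n, AEStronglyMeasurable (L n) (volume.restrict U))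
    (hw : ∀ᶠ n : ℕ in l, √n * ‖w n‖ ≤ B)
    (hL : IsLocallyQuadratic S a l L fun n => S *ᵥ (w n).ofLp) :
    ∃ δ : ℝ, 0 < δ ∧ Tendsto (fun n : ℕ => ∫⁻ t,
      ‖{t | ‖(√n)⁻¹ • t + w n‖ < δ}.indicator (localWeight S U prior a (L n) (w n) n) t -
        Real.exp (-(1 / 2) * quadForm S t) * prior a‖ₑ) l (𝓝 0) := by
  have hhalf : ((1 / 2 : ℝ) • S).PosDef := hS.smul one_half_pos
  obtain ⟨δ, A, hδ, hA, hbound⟩ := exists_abs_localWeight_le (U := U) hl hS hcont hw hL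
  refine ⟨δ, hδ, tendsto_lintegral_enorm_sub_of_dominated ?_
    ((integrable_exp_neg_half_quadForm hS).mul_const _)
    ((integrable_exp_neg_half_quadForm hhalf).const_mul A) ?_ fun t => ?_⟩
  · filter_upwards [hl (eventually_ne_atTop 0)] with n hn
    exact (aestronglyMeasurable_localWeight hUm hprior (hLm n) (w n) hn).indicator
      (measurableSet_lt (by fun_prop) measurable_const)
  · filter_upwards [hbound] with n hn t
    by_cases ht : ‖(√n)⁻¹ • t + w n‖ < δ
    · rw [indicator_of_mem (mem_ofPred_eq ▸ ht)]
      exact hn t ht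
    · rw [indicator_of_notMem (mem_ofPred_eq ▸ ht), abs_zero]
      positivity
  · have hsymm : S.IsSymm := Matrix.isHermitian_iff_isSymm.1 hS.isHermitian
    refine (tendsto_localWeight hl hsymm hU hcont hw hL t).congr' ?_
    filter_upwards [(tendsto_inv_sqrt_smul_add hl hw t).norm.eventually_lt_const
      (norm_zero.trans_lt hδ)] with n hn
    rw [indicator_of_mem (mem_ofPred_eq ▸ hn)]

theorem enorm_localWeight_le {L : Param d → ℝ} {w : Param d} (hS : S.PosSemidef) {κ δ : ℝ}
    (hL : ∀ α ∈ U, δ ≤ ‖α - a‖ → L α ≤ L a - κ) {n : ℕ} {t : Param d}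
    (ht : δ ≤ ‖(√n)⁻¹ • t + w‖) :
    ‖localWeight S U prior a L w n t‖ₑ ≤ ENNReal.ofReal (Real.exp (-(n * κ))) *
      ‖U.indicator prior ((√n)⁻¹ • t + (a + w))‖ₑ := by
  rw [localWeight]
  by_cases hα : (√n)⁻¹ • t + (a + w) ∈ U
  · rw [indicator_of_mem hα, indicator_of_mem hα, enorm_mul,
      Real.enorm_of_nonneg (Real.exp_pos _).le]
    have hgap := hL _ hα (by rwa [add_left_comm, add_sub_cancel_left])
    have hquad : 0 ≤ quadForm S w := hS.dotProduct_mulVec_nonneg w.ofLp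
    have hexponent : L ((√n)⁻¹ • t + (a + w)) - L a - 1 / 2 * quadForm S w ≤ -κ := by linarith
    gcongr
    exact (mul_le_mul_of_nonneg_left hexponent n.cast_nonneg).trans_eq (mul_neg _ _)
  · rw [indicator_of_notMem hα, enorm_zero]
    exact zero_le

theorem tendsto_exp_neg_mul_mul_sqrt_pow {κ : ℝ} (hκ : 0 < κ) (d : ℕ) :
    Tendsto (fun n : ℕ => Real.exp (-(n * κ)) * √n ^ d) atTop (𝓝 0) := by
  refine ((tendsto_rpow_mul_exp_neg_mul_atTop_nhds_zero ((d : ℝ) / 2) κ hκ).comp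
    tendsto_natCast_atTop_atTop).congr fun n => ?_
  rw [Function.comp_apply, mul_comm, Real.sqrt_eq_rpow, ← Real.rpow_natCast,
    ← Real.rpow_mul n.cast_nonneg]
  congr 2 <;> ring

theorem tendsto_lintegral_indicator_compl_localWeight (hl : l ≤ atTop) (hS : S.PosSemidef)
    (hUm : MeasurableSet U) (hprior : IntegrableOn prior U) (hL : IsWellSeparatedMax U a l L)
    {δ : ℝ} (hδ : 0 < δ) :
    Tendsto (fun n : ℕ => ∫⁻ t,
      ‖{t | ‖(√n)⁻¹ • t + w n‖ < δ}ᶜ.indicator (localWeight S U prior a (L n) (w n) n) t‖ₑ)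
      l (𝓝 0) := by
  obtain ⟨κ, hκ, hgap⟩ := hL δ hδ
  have hmass : ∫⁻ α, ‖U.indicator prior α‖ₑ ≠ ∞ := ((integrable_indicator_iff hUm).2 hprior).2.ne
  have hlim : Tendsto (fun n : ℕ => ENNReal.ofReal (Real.exp (-(n * κ)) * √n ^ d) *
      ∫⁻ α, ‖U.indicator prior α‖ₑ) l (𝓝 0) := by
    simpa using ENNReal.Tendsto.mul_const
      (ENNReal.tendsto_ofReal ((tendsto_exp_neg_mul_mul_sqrt_pow hκ d).mono_left hl))
      (Or.inr hmass)
  refine tendsto_of_tendsto_of_tendsto_of_le_of_le' tendsto_const_nhds hlim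
    (Eventually.of_forall fun _ => zero_le) ?_
  filter_upwards [hgap, hl (eventually_ne_atTop 0)] with n hn hn0
  calc _ ≤ ∫⁻ t : Param d, ENNReal.ofReal (Real.exp (-(n * κ))) *
        ‖U.indicator prior ((√n)⁻¹ • t + (a + w n))‖ₑ := by
        refine lintegral_mono fun t => ?_
        by_cases ht : ‖(√n)⁻¹ • t + w n‖ < δ
        · rw [indicator_of_notMem (notMem_compl_iff.2 (mem_ofPred_eq ▸ ht)), enorm_zero]
          exact zero_le
        · rw [indicator_of_mem (mem_compl (mem_ofPred_eq ▸ ht))]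
          exact enorm_localWeight_le hS hn (not_lt.1 ht)
    _ = _ := by
        rw [lintegral_const_mul' _ _ ENNReal.ofReal_ne_top,
          lintegral_comp_inv_smul_add volume (fun α => ‖U.indicator prior α‖ₑ)
            (Real.sqrt_pos.2 (by positivity)), finrank_euclideanSpace_fin, ← mul_assoc,
          ← ENNReal.ofReal_mul (Real.exp_pos _).le]

theorem tendsto_lintegral_localWeight_sub [l.IsCountablyGenerated]
    (hl : l ≤ atTop) (hS : S.PosDef) (hUm : MeasurableSet U) (hU : U ∈ 𝓝 a)
    (hprior : IntegrableOn prior U) (hcont : ContinuousAt prior a)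
    (hLm : ∀ n, AEStronglyMeasurable (L n) (volume.restrict U))
    (hw : ∀ᶠ n : ℕ in l, √n * ‖w n‖ ≤ B)
    (hquad : IsLocallyQuadratic S a l L fun n => S *ᵥ (w n).ofLp)
    (hsep : IsWellSeparatedMax U a l L) :
    Tendsto (fun n : ℕ => ∫⁻ t, ‖localWeight S U prior a (L n) (w n) n t -
      Real.exp (-(1 / 2) * quadForm S t) * prior a‖ₑ) l (𝓝 0) := by
  obtain ⟨δ, hδ, hin⟩ := exists_tendsto_lintegral_indicator_localWeight_sub hl hS hUm hU
    hprior.1 hcont hLm hw hquad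
  have hout := tendsto_lintegral_indicator_compl_localWeight (w := w) hl hS.posSemidef hUm
    hprior hsep hδ
  refine tendsto_of_tendsto_of_tendsto_of_le_of_le' tendsto_const_nhds
    (by simpa only [add_zero] using hin.add hout) (Eventually.of_forall fun _ => zero_le) ?_
  filter_upwards [hl (eventually_ne_atTop 0)] with n hn
  set W := localWeight S U prior a (L n) (w n) n
  set near : Set (Param d) := {t | ‖(√n)⁻¹ • t + w n‖ < δ}
  have hnear : MeasurableSet near := measurableSet_lt (by fun_prop) measurable_const
  have hW : AEStronglyMeasurable W := aestronglyMeasurable_localWeight hUm hprior.1 (hLm n) _ hn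
  have hgauss := (integrable_exp_neg_half_quadForm hS).mul_const (prior a)
  have hm := ((hW.indicator hnear).sub hgauss.1).enorm
  simp only [Pi.sub_apply] at hm
  rw [← lintegral_add_left' hm]
  refine lintegral_mono fun t => ?_
  have hsplit : near.indicator W t + nearᶜ.indicator W t = W t :=
    congrFun (indicator_self_add_compl near W) t
  rw [← hsplit, add_sub_right_comm]
  exact enorm_add_le _ _

-- A Laplace approximation: the limit `prior a * exp(-tᵀ S t / 2)` of the weights is, up to its
-- total mass, the Gaussian density.
theorem tendsto_lintegral_localWeight_div_integral_sub [l.IsCountablyGenerated]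
    (hl : l ≤ atTop) (hS : S.PosDef) (hUm : MeasurableSet U) (hU : U ∈ 𝓝 a)
    (hprior : IntegrableOn prior U) (hcont : ContinuousAt prior a) (hprior0 : prior a ≠ 0)
    (hLm : ∀ n, AEStronglyMeasurable (L n) (volume.restrict U))
    (hw : ∀ᶠ n : ℕ in l, √n * ‖w n‖ ≤ B)
    (hquad : IsLocallyQuadratic S a l L fun n => S *ᵥ (w n).ofLp)
    (hsep : IsWellSeparatedMax U a l L) :
    Tendsto (fun n : ℕ => ∫⁻ t, ‖localWeight S U prior a (L n) (w n) n t /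
      (∫ s, localWeight S U prior a (L n) (w n) n s) - gaussianDensity S t‖ₑ) l (𝓝 0) := by
  have hmeas : ∀ᶠ n in l, AEStronglyMeasurable (localWeight S U prior a (L n) (w n) n) := by
    filter_upwards [hl (eventually_ne_atTop 0)] with n hn
    exact aestronglyMeasurable_localWeight hUm hprior.1 (hLm n) (w n) hn
  have hdensity : ∀ t, Real.exp (-(1 / 2) * quadForm S t) * prior a /
      (∫ u : Param d, Real.exp (-(1 / 2) * quadForm S u) * prior a) = gaussianDensity S t := by
    intro t
    rw [integral_mul_const, gaussianDensity_eq_div_integral hS, mul_div_mul_right _ _ hprior0]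
  have hmass : ∫ t : Param d, Real.exp (-(1 / 2) * quadForm S t) * prior a ≠ 0 := by
    rw [integral_mul_const]
    exact mul_ne_zero (integral_exp_neg_half_quadForm_pos hS).ne' hprior0
  simpa only [hdensity] using tendsto_lintegral_enorm_div_integral_sub hmeas
    ((integrable_exp_neg_half_quadForm hS).mul_const (prior a)) hmass
    (tendsto_lintegral_localWeight_sub hl hS hUm hU hprior hcont hLm hw hquad hsep)

end LaplaceLimit

section Population

variable {d : ℕ} {𝒳 : Type*} [MeasurableSpace 𝒳] {φ : ℝ → ℝ} {M : Model d 𝒳} {θ θ₀ : Param d}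

namespace HasDominatedThirdPartials

theorem exists_taylorBound_integral_h (hR2 : HasDominatedThirdPartials φ M θ θ₀)
    (hh : ∀ α ∈ finiteSet φ M θ, Integrable (h φ M θ α) (M.law θ₀))
    (hgrad : ∀ i, Integrable (fun x => gradH φ M θ θ₀ x i) (M.law θ₀))
    (hhess : ∀ i j, Integrable (fun x => hessH φ M θ θ₀ x i j) (M.law θ₀)) :
    ∃ r : ℝ, 0 < r ∧ (∀ v : Param d, ‖v‖ < r → θ₀ + v ∈ finiteSet φ M θ) ∧
      ∃ K : ℝ, TaylorBound r θ₀ (fun α => ∫ x, h φ M θ α x ∂(M.law θ₀))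
        (fun i => ∫ x, gradH φ M θ θ₀ x i ∂(M.law θ₀)) (-matS φ M θ θ₀) K := by
  obtain ⟨r, hr, hmem, K, hK, hT⟩ := hR2.exists_taylorBound
  have hneg : -matS φ M θ θ₀ = Matrix.of fun i j => ∫ x, hessH φ M θ θ₀ x i j ∂(M.law θ₀) := by
    ext i j
    exact neg_neg _
  rw [hneg]
  exact ⟨r, hr, hmem, _, .integral (fun v hv => hh _ (hmem v hv)) hgrad hhess hK hT⟩

theorem integral_gradH_eq_zero (hR2 : HasDominatedThirdPartials φ M θ θ₀)
    (hh : ∀ α ∈ finiteSet φ M θ, Integrable (h φ M θ α) (M.law θ₀))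
    (hgrad : ∀ i, Integrable (fun x => gradH φ M θ θ₀ x i) (M.law θ₀))
    (hhess : ∀ i j, Integrable (fun x => hessH φ M θ θ₀ x i j) (M.law θ₀))
    (hmax : IsMaxOn (fun α => ∫ x, h φ M θ α x ∂(M.law θ₀)) (finiteSet φ M θ) θ₀) (i : Fin d) :
    ∫ x, gradH φ M θ θ₀ x i ∂(M.law θ₀) = 0 := by
  obtain ⟨r, hr, hmem, K, hT⟩ := hR2.exists_taylorBound_integral_h hh hgrad hhess
  exact congrFun (hT.gradient_eq_zero_of_isMax hr fun v hv => hmax (hmem v hv)) i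

theorem posDef_matS (hR2 : HasDominatedThirdPartials φ M θ θ₀)
    (hh : ∀ α ∈ finiteSet φ M θ, Integrable (h φ M θ α) (M.law θ₀))
    (hgrad : ∀ i, Integrable (fun x => gradH φ M θ θ₀ x i) (M.law θ₀))
    (hhess : ∀ i j, Integrable (fun x => hessH φ M θ θ₀ x i j) (M.law θ₀))
    (hmax : IsMaxOn (fun α => ∫ x, h φ M θ α x ∂(M.law θ₀)) (finiteSet φ M θ) θ₀)
    (hdet : (matS φ M θ θ₀).det ≠ 0) : (matS φ M θ θ₀).PosDef := by
  obtain ⟨r, hr, hmem, K, hT⟩ := hR2.exists_taylorBound_integral_h hh hgrad hhess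
  refine posDef_of_quadForm_nonneg ?_ (fun v => ?_) hdet
  · ext i j
    exact congrArg Neg.neg (integral_congr_ae (hR2.isSymm_hessH.mono fun x hx => hx.apply i j))
  · have hneg := hT.quadForm_nonpos_of_isMax hr (fun v hv => hmax (hmem v hv)) v
    rwa [quadForm_neg_matrix, neg_nonpos] at hneg

end HasDominatedThirdPartials

end Population

section PosteriorMeasurability

variable {d : ℕ} {𝒳 Ω : Type*} [MeasurableSpace 𝒳] {φ ψ : ℝ → ℝ}
  {M : Model d 𝒳} {θ θ₀ : Param d} {X : ℕ → Ω → 𝒳} {prior q : Param d → ℝ} {G : Param d → ℝ}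

theorem posterior_ae_eq (hφψ : EqOn φ ψ (Ioi 0)) (hψ : Measurable ψ) (hθ : θ ∈ M.Θ)
    (hq : prior =ᵐ[volume.restrict (finiteSet ψ M θ)] q) (n : ℕ) (ω : Ω) :
    posterior φ M θ prior X n ω =ᵐ[volume] posterior ψ M θ q X n ω := by
  have hU := measurableSet_finiteSet hψ M θ
  have hweight : posteriorWeight φ M θ prior X n ω =ᵐ[volume.restrict (finiteSet ψ M θ)]
      posteriorWeight ψ M θ q X n ω := by
    filter_upwards [hq, ae_restrict_mem hU] with α hα hαU
    rw [posteriorWeight, posteriorWeight, hα, h_congr hφψ hθ hαU.1]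
  filter_upwards [(ae_eq_restrict_iff_indicator_ae_eq hU).1 hweight] with α hα
  rw [posterior, posterior, finiteSet_congr hφψ hθ, hα, integral_congr_ae hweight]

variable [MeasurableSpace Ω]

theorem measurable_empMean_h (hφ : Measurable φ) (M : Model d 𝒳) (θ : Param d)
    (hX : ∀ i, Measurable (X i)) (n : ℕ) :
    Measurable fun z : Ω × Param d => empMean X n z.1 (h φ M θ z.2) :=
  (Finset.measurable_fun_sum _ fun i _ => (measurable_h hφ M θ).comp
    (measurable_snd.prodMk ((hX i).comp measurable_fst))).const_mul _

theorem measurable_posterior (hφ : Measurable φ) (M : Model d 𝒳) (θ : Param d)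
    (hX : ∀ i, Measurable (X i)) (hprior : Measurable prior) (n : ℕ) :
    Measurable fun z : Ω × Param d => posterior φ M θ prior X n z.1 z.2 := by
  have hweight : Measurable fun z : Ω × Param d => posteriorWeight φ M θ prior X n z.1 z.2 :=
    ((measurable_empMean_h hφ M θ hX n).const_mul _).exp.mul (hprior.comp measurable_snd)
  have hmass : Measurable fun ω => ∫ β in finiteSet φ M θ, posteriorWeight φ M θ prior X n ω β :=
    hweight.stronglyMeasurable.integral_prod_right'.measurable
  exact (hweight.indicator (measurable_snd (measurableSet_finiteSet hφ M θ))).div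
    (hmass.comp measurable_fst)

theorem aemeasurable_lintegral_rescaledPosterior_sub {μ : Measure Ω}
    (hφ : IsDivergenceGenerator φ) (hθ : θ ∈ M.Θ) (hX : ∀ i, Measurable (X i))
    (hprior : AEStronglyMeasurable prior (volume.restrict (finiteSet φ M θ))) (hG : Measurable G)
    {n : ℕ} (hn : n ≠ 0) (hcenter : AEMeasurable (center φ M θ θ₀ X n) μ) :
    AEMeasurable (fun ω => ∫⁻ t, ‖rescaledPosterior φ M θ θ₀ prior X n ω t - G t‖ₑ) μ := by
  have hφψ : EqOn φ ((Ioi 0).indicator φ) (Ioi 0) := eqOn_indicator.symm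
  have hψ := hφ.measurable_indicator
  set ψ := (Ioi 0).indicator φ
  have hq := hprior.stronglyMeasurable_mk.measurable
  have hpq := hprior.ae_eq_mk
  set q := hprior.mk prior
  have hdist : Measurable fun z : Ω × Param d => ∫⁻ t : Param d,
      ‖(√n ^ d)⁻¹ * posterior ψ M θ q X n z.1 ((√n)⁻¹ • t + z.2) - G t‖ₑ := by
    have hpoint : Measurable fun z : (Ω × Param d) × Param d =>
        (z.1.1, (√n)⁻¹ • z.2 + z.1.2) := by fun_prop
    exact ((((measurable_posterior hψ M θ hX hq n).comp hpoint).const_mul _).sub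
      (hG.comp measurable_snd)).enorm.lintegral_prod_right'
  refine (hdist.comp_aemeasurable (aemeasurable_id.prodMk hcenter)).congr (ae_of_all _ fun ω => ?_)
  refine lintegral_congr_ae ?_
  rw [finiteSet_congr hφψ hθ] at hpq
  filter_upwards [(quasiMeasurePreserving_inv_smul_add volume
    (Real.sqrt_pos.2 (by positivity : (0 : ℝ) < n)) (center φ M θ θ₀ X n ω)).ae
    (posterior_ae_eq hφψ hψ hθ hpq n ω)] with t ht
  rw [rescaledPosterior, ht]
  rfl

theorem IsDivergenceGenerator.measurableSet_finiteSet (hφ : IsDivergenceGenerator φ)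
    (hθ : θ ∈ M.Θ) : MeasurableSet (finiteSet φ M θ) := by
  rw [finiteSet_congr eqOn_indicator.symm hθ]
  exact PhiPosterior.measurableSet_finiteSet hφ.measurable_indicator M θ

theorem aestronglyMeasurable_empMean_h (hφ : IsDivergenceGenerator φ) (hθ : θ ∈ M.Θ)
    (hX : ∀ i, Measurable (X i)) (n : ℕ) (ω : Ω) :
    AEStronglyMeasurable (fun α => empMean X n ω (h φ M θ α))
      (volume.restrict (finiteSet φ M θ)) := by
  have hφψ : EqOn φ ((Ioi 0).indicator φ) (Ioi 0) := eqOn_indicator.symm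
  have hψ := hφ.measurable_indicator
  have hmeas := (measurable_empMean_h hψ M θ hX n).comp (measurable_prodMk_left (x := ω))
  refine hmeas.aestronglyMeasurable.congr ?_
  filter_upwards [ae_restrict_mem (hφ.measurableSet_finiteSet hθ)] with α hα
  simp only [Function.comp_apply, h_congr hφψ hθ hα.1]

end PosteriorMeasurability

section Tightness

variable {Ω : Type*} [MeasurableSpace Ω] {μ : Measure Ω}

theorem exists_measure_lt_sqrt_mul_norm_empMean_le [IsProbabilityMeasure μ] {𝒳 ι : Type*}
    [MeasurableSpace 𝒳] [Fintype ι] {X : ℕ → Ω → 𝒳} {ν : Measure 𝒳} {f : ι → 𝒳 → ℝ}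
    (hX : ∀ i, Measurable (X i)) (hindep : Pairwise fun i j => X i ⟂ᵢ[μ] X j)
    (hlaw : ∀ i, μ.map (X i) = ν) (hf : ∀ k, MemLp (f k) 2 ν) (hmean : ∀ k, ∫ x, f k x ∂ν = 0)
    {η : ℝ≥0∞} (hη : 0 < η) :
    ∃ b : ℝ, ∀ n : ℕ, μ {ω | b < √n * ‖fun k => empMean X n ω (f k)‖} ≤ η := by
  have hlim : Tendsto (fun b : ℝ => ∑ k, ENNReal.ofReal (variance (f k) ν / b ^ 2)) atTop
      (𝓝 0) := by
    have hterm := fun k => ENNReal.tendsto_ofReal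
      ((tendsto_const_nhds (x := variance (f k) ν)).div_atTop (tendsto_pow_atTop two_ne_zero))
    simpa using tendsto_finsetSum Finset.univ fun k _ => hterm k
  obtain ⟨b, hbη, hb⟩ :=
    ((ENNReal.tendsto_nhds_zero.1 hlim η hη).and (eventually_gt_atTop 0)).exists
  refine ⟨b, fun n => le_trans ?_ hbη⟩
  have hsub : {ω | b < √n * ‖fun k => empMean X n ω (f k)‖} ⊆
      ⋃ k, {ω | b ≤ √n * |empMean X n ω (f k) - ∫ x, f k x ∂ν|} := by
    intro ω hω
    by_contra hnot
    simp only [hmean, sub_zero, mem_iUnion, mem_ofPred_eq, not_exists, not_le] at hnot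
    rw [mem_ofPred_eq, ← Real.norm_of_nonneg (Real.sqrt_nonneg _), ← norm_smul] at hω
    refine hω.not_ge ((pi_norm_le_iff_of_nonneg hb.le).2 fun k => ?_)
    rw [Pi.smul_apply, norm_smul, Real.norm_of_nonneg (Real.sqrt_nonneg _)]
    exact (hnot k).le
  exact (measure_mono hsub).trans <| (measure_iUnion_fintype_le _ _).trans <|
    Finset.sum_le_sum fun k _ => measure_le_sqrt_mul_abs_empMean_sub hX hindep hlaw (hf k) hb n

variable [IsFiniteMeasure μ]

theorem tendsto_measure_of_ae_eventually_notMem {A : ℕ → Set Ω}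
    (hA : ∀ᶠ n in atTop, NullMeasurableSet (A n) μ) (h : ∀ᵐ ω ∂μ, ∀ᶠ n in atTop, ω ∉ A n) :
    Tendsto (fun n => μ (A n)) atTop (𝓝 0) := by
  have hlim : Tendsto (fun n => ∫⁻ ω, (A n).indicator 1 ω ∂μ) atTop (𝓝 (∫⁻ _, 0 ∂μ)) := by
    refine tendsto_lintegral_filter_of_dominated_convergence' (fun _ => 1)
      (hA.mono fun n hn => (aemeasurable_indicator_const_iff 1).2 hn)
      (Eventually.of_forall fun n => ae_of_all _ (indicator_le_self' fun _ _ => zero_le_one))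
      (by simp) ?_
    filter_upwards [h] with ω hω
    exact tendsto_const_nhds.congr' (hω.mono fun n hn => (indicator_of_notMem hn 1).symm)
  rw [lintegral_zero] at hlim
  exact hlim.congr' (hA.mono fun n hn => lintegral_indicator_one₀ hn)

theorem tendsto_measure_le_of_tight {F : ℕ → Ω → ℝ≥0∞} {Z : ℕ → Ω → ℝ}
    (hF : ∀ᶠ n in atTop, AEMeasurable (F n) μ) (hZ : ∀ n, AEMeasurable (Z n) μ)
    (htight : ∀ η : ℝ≥0∞, 0 < η → ∃ b : ℝ, ∀ n, μ {ω | b < Z n ω} ≤ η)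
    (hlim : ∀ b : ℝ, ∀ᵐ ω ∂μ, Tendsto (fun n => F n ω) (atTop ⊓ 𝓟 {n | Z n ω ≤ b}) (𝓝 0))
    {ε : ℝ≥0∞} (hε : 0 < ε) : Tendsto (fun n => μ {ω | ε ≤ F n ω}) atTop (𝓝 0) := by
  rw [ENNReal.tendsto_nhds_zero]
  intro η hη
  obtain ⟨b, hb⟩ := htight (η / 2) (ENNReal.half_pos hη.ne')
  have hbounded : Tendsto (fun n => μ ({ω | ε ≤ F n ω} ∩ {ω | Z n ω ≤ b})) atTop (𝓝 0) := by
    refine tendsto_measure_of_ae_eventually_notMem ?_ ?_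
    · filter_upwards [hF] with n hn
      exact (nullMeasurableSet_le aemeasurable_const hn).inter
        (nullMeasurableSet_le (hZ n) aemeasurable_const)
    · filter_upwards [hlim b] with ω hω
      filter_upwards [eventually_inf_principal.1 (hω.eventually_lt_const hε)] with n hn hmem
      exact (hn hmem.2).not_ge hmem.1
  filter_upwards [ENNReal.tendsto_nhds_zero.1 hbounded (η / 2) (ENNReal.half_pos hη.ne')]
    with n hn
  calc μ {ω | ε ≤ F n ω}
      ≤ μ (({ω | ε ≤ F n ω} ∩ {ω | Z n ω ≤ b}) ∪ {ω | b < Z n ω}) := by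
        refine measure_mono fun ω hω => ?_
        exact (le_or_gt (Z n ω) b).imp (fun hle => ⟨hω, hle⟩) id
    _ ≤ η / 2 + η / 2 := (measure_union_le _ _).trans (add_le_add hn (hb n))
    _ = η := ENNReal.add_halves η

end Tightness

section Posterior

variable {d : ℕ} {𝒳 Ω : Type*} [MeasurableSpace 𝒳] {φ : ℝ → ℝ} {M : Model d 𝒳}
  {θ θ₀ : Param d} {X : ℕ → Ω → 𝒳} {prior : Param d → ℝ}

/-- The displacement `Δ_n - θ₀ = S⁻¹ U_n(θ₀)` of the centring point, that is, the maximizer of the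
quadratic part of the criterion. -/
def newtonStep (φ : ℝ → ℝ) (M : Model d 𝒳) (θ θ₀ : Param d) (X : ℕ → Ω → 𝒳) (n : ℕ) (ω : Ω) :
    Param d :=
  WithLp.toLp 2 ((matS φ M θ θ₀)⁻¹ *ᵥ score φ M θ θ₀ X n ω)

theorem mulVec_newtonStep (hdet : (matS φ M θ θ₀).det ≠ 0) (n : ℕ) (ω : Ω) :
    matS φ M θ θ₀ *ᵥ (newtonStep φ M θ θ₀ X n ω).ofLp = score φ M θ θ₀ X n ω := by
  rw [newtonStep, Matrix.mulVec_mulVec, Matrix.mul_nonsing_inv _ (isUnit_iff_ne_zero.2 hdet),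
    Matrix.one_mulVec]

theorem exists_norm_newtonStep_le (φ : ℝ → ℝ) (M : Model d 𝒳) (θ θ₀ : Param d)
    (X : ℕ → Ω → 𝒳) :
    ∃ C : ℝ, 0 ≤ C ∧ ∀ n ω, ‖newtonStep φ M θ θ₀ X n ω‖ ≤ C * ‖score φ M θ θ₀ X n ω‖ := by
  let A : (Fin d → ℝ) →L[ℝ] Param d := ((WithLp.linearEquiv 2 ℝ (Fin d → ℝ)).symm.toLinearMap ∘ₗ
    (matS φ M θ θ₀)⁻¹.mulVecLin).toContinuousLinearMap
  exact ⟨‖A‖, norm_nonneg A, fun n ω => A.le_opNorm (score φ M θ θ₀ X n ω)⟩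

theorem rescaledPosterior_eq_localWeight_div (S : Matrix (Fin d) (Fin d) ℝ)
    (hU : MeasurableSet (finiteSet φ M θ)) {n : ℕ} (hn : n ≠ 0) (ω : Ω) (t : Param d) :
    rescaledPosterior φ M θ θ₀ prior X n ω t =
      localWeight S (finiteSet φ M θ) prior θ₀ (fun α => empMean X n ω (h φ M θ α))
          (newtonStep φ M θ θ₀ X n ω) n t /
        ∫ s, localWeight S (finiteSet φ M θ) prior θ₀ (fun α => empMean X n ω (h φ M θ α))
          (newtonStep φ M θ θ₀ X n ω) n s := by
  rw [localWeight_div_integral hU _ _ hn, rescaledPosterior]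
  rfl

variable [MeasurableSpace Ω] {μ : Measure Ω}

theorem aemeasurable_score (hX : ∀ i, Measurable (X i)) (hlaw : ∀ i, μ.map (X i) = M.law θ₀)
    (hgrad : ∀ i, AEMeasurable (fun x => gradH φ M θ θ₀ x i) (M.law θ₀)) (n : ℕ) :
    AEMeasurable (score φ M θ θ₀ X n) μ := by
  refine aemeasurable_pi_lambda _ fun i => ?_
  have hterm : ∀ k, AEMeasurable (fun ω => gradH φ M θ θ₀ (X k ω) i) μ := fun k =>
    AEMeasurable.comp_measurable (g := fun x => gradH φ M θ θ₀ x i)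
      (by simpa only [hlaw k] using hgrad i) (hX k)
  exact (Finset.aemeasurable_fun_sum _ fun k _ => hterm k).const_mul _

theorem aemeasurable_center {n : ℕ} (hscore : AEMeasurable (score φ M θ θ₀ X n) μ) :
    AEMeasurable (center φ M θ θ₀ X n) μ := by
  have hcont : Continuous fun u : Fin d → ℝ =>
      θ₀ + (WithLp.toLp 2 ((matS φ M θ θ₀)⁻¹ *ᵥ u) : Param d) := by fun_prop
  exact hcont.measurable.comp_aemeasurable hscore

theorem ae_isLocallyQuadratic_empMean (hX : ∀ i, Measurable (X i))
    (hindep : Pairwise fun i j => X i ⟂ᵢ[μ] X j) (hlaw : ∀ i, μ.map (X i) = M.law θ₀)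
    (hR2 : HasDominatedThirdPartials φ M θ θ₀)
    (hhess : ∀ i j, Integrable (fun x => hessH φ M θ θ₀ x i j) (M.law θ₀)) :
    ∀ᵐ ω ∂μ, IsLocallyQuadratic (matS φ M θ θ₀) θ₀ atTop
      (fun n α => empMean X n ω (h φ M θ α)) (fun n => score φ M θ θ₀ X n ω) := by
  obtain ⟨r, hr, -, K, hK, hT⟩ := hR2.exists_taylorBound
  have hTX : ∀ᵐ ω ∂μ, ∀ k, TaylorBound r θ₀ (fun α => h φ M θ α (X k ω))
      (gradH φ M θ θ₀ (X k ω)) (hessH φ M θ θ₀ (X k ω)) (K (X k ω)) :=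
    ae_all_iff.2 fun k => ae_of_ae_map (hX k).aemeasurable (by rwa [hlaw k])
  have hlim : ∀ᵐ ω ∂μ, ∀ i j, Tendsto (fun n => empMean X n ω fun x => hessH φ M θ θ₀ x i j) atTop
      (𝓝 (-matS φ M θ θ₀ i j)) := by
    refine ae_all_iff.2 fun i => ae_all_iff.2 fun j => ?_
    simpa [matS] using tendsto_empMean hX hindep hlaw (hhess i j)
  filter_upwards [hTX, hlim, tendsto_empMean hX hindep hlaw hK] with ω hTω hhessω hKω
  exact isLocallyQuadratic_of_taylorBound hr
    (fun n => TaylorBound.empMean (F := h φ M θ) hTω n) hhessω hKω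

theorem ae_isWellSeparatedMax_empMean (hφ : IsDivergenceGenerator φ) (hθ : θ ∈ M.Θ)
    (hθ₀ : θ₀ ∈ finiteSet φ M θ)
    (hint : ∀ α ∈ finiteSet φ M θ, Integrable (dualIntegrand φ M θ α) M.dom)
    (hsep : SeparatedFrom φ M θ θ₀) (R1 : CondR1 φ M θ θ₀ μ X) :
    ∀ᵐ ω ∂μ, IsWellSeparatedMax (finiteSet φ M θ) θ₀ atTop
      fun n α => empMean X n ω (h φ M θ α) := by
  have hmean : IsWellSeparatedMax (finiteSet φ M θ) θ₀ atTop
      fun (_ : ℕ) α => ∫ x, h φ M θ α x ∂(M.law θ₀) := fun δ hδ =>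
    (exists_integral_h_le_sub hφ hθ hθ₀ hint R1.integrable_h hsep hδ).imp fun _ hκ =>
      ⟨hκ.1, Eventually.of_forall fun _ => hκ.2⟩
  exact R1.tendsto_sup.mono fun ω hω => hmean.of_tendsto_iSup hθ₀ hω

theorem tendsto_lintegral_rescaledPosterior_sub {ω : Ω} {l : Filter ℕ} [l.IsCountablyGenerated]
    {b : ℝ} (hl : l ≤ atTop) (hφ : IsDivergenceGenerator φ) (hθ : θ ∈ M.Θ)
    (hX : ∀ i, Measurable (X i)) (hS : (matS φ M θ θ₀).PosDef) (hU : finiteSet φ M θ ∈ 𝓝 θ₀)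
    (hprior : IntegrableOn prior (finiteSet φ M θ)) (hcont : ContinuousAt prior θ₀)
    (hprior0 : prior θ₀ ≠ 0)
    (hquad : IsLocallyQuadratic (matS φ M θ θ₀) θ₀ atTop
      (fun n α => empMean X n ω (h φ M θ α)) (fun n => score φ M θ θ₀ X n ω))
    (hsep : IsWellSeparatedMax (finiteSet φ M θ) θ₀ atTop fun n α => empMean X n ω (h φ M θ α))
    (hscore : ∀ᶠ n : ℕ in l, √n * ‖score φ M θ θ₀ X n ω‖ ≤ b) :
    Tendsto (fun n => ∫⁻ t, ‖rescaledPosterior φ M θ θ₀ prior X n ω t -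
      gaussianDensity (matS φ M θ θ₀) t‖ₑ) l (𝓝 0) := by
  have hUm := hφ.measurableSet_finiteSet hθ
  obtain ⟨C, hC, hstep⟩ := exists_norm_newtonStep_le φ M θ θ₀ X
  have hw : ∀ᶠ n : ℕ in l, √n * ‖newtonStep φ M θ θ₀ X n ω‖ ≤ C * b := by
    filter_upwards [hscore] with n hn
    calc √n * ‖newtonStep φ M θ θ₀ X n ω‖ ≤ √n * (C * ‖score φ M θ θ₀ X n ω‖) := by
          gcongr
          exact hstep n ω
      _ = C * (√n * ‖score φ M θ θ₀ X n ω‖) := mul_left_comm _ _ _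
      _ ≤ C * b := by gcongr
  have hquad' := hquad.mono hl
  simp only [← mulVec_newtonStep hS.det_pos.ne'] at hquad'
  refine (tendsto_lintegral_localWeight_div_integral_sub hl hS hUm hU hprior hcont hprior0
    (fun n => aestronglyMeasurable_empMean_h hφ hθ hX n ω) hw hquad' (hsep.mono hl)).congr' ?_
  filter_upwards [hl (eventually_ne_atTop 0)] with n hn
  simp only [rescaledPosterior_eq_localWeight_div (matS φ M θ θ₀) hUm hn]

end Posterior

end PhiPosterior

end

theorem theorem1_general {d : ℕ} {𝒳 : Type*} [MeasurableSpace 𝒳]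
    (M : PhiPosterior.Model d 𝒳)
    (φ : ℝ → ℝ) (hφ : PhiPosterior.IsDivergenceGenerator φ)
    (θ θ₀ : PhiPosterior.Param d) (hθ : θ ∈ M.Θ)
    (hint : ∀ α ∈ PhiPosterior.finiteSet φ M θ,
      Integrable (PhiPosterior.dualIntegrand φ M θ α) M.dom)
    (hsep : PhiPosterior.SeparatedFrom φ M θ θ₀)
    {Ω : Type*} [MeasurableSpace Ω] (μ : Measure Ω) [IsProbabilityMeasure μ]
    (X : ℕ → Ω → 𝒳) (hX : ∀ i, Measurable (X i))
    (hindep : Pairwise fun i j => X i ⟂ᵢ[μ] X j) (hlaw : ∀ i, μ.map (X i) = M.law θ₀)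
    (R1 : PhiPosterior.CondR1 φ M θ θ₀ μ X)
    (R2 : PhiPosterior.HasDominatedThirdPartials φ M θ θ₀)
    (hhess : ∀ i j, Integrable (fun x => PhiPosterior.hessH φ M θ θ₀ x i j) (M.law θ₀))
    (hgrad : ∀ i, MemLp (fun x => PhiPosterior.gradH φ M θ θ₀ x i) 2 (M.law θ₀))
    (hdet : (PhiPosterior.matS φ M θ θ₀).det ≠ 0)
    (prior : PhiPosterior.Param d → ℝ)
    (hprior_int : IntegrableOn prior (PhiPosterior.finiteSet φ M θ))
    (hprior_cont : ContinuousAt prior θ₀)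
    (hprior_ne_zero : prior θ₀ ≠ 0) :
    ∀ ε : ℝ, 0 < ε →
      Tendsto (fun n : ℕ => μ {ω | ENNReal.ofReal ε ≤
        ∫⁻ t, ‖PhiPosterior.rescaledPosterior φ M θ θ₀ prior X n ω t
          - PhiPosterior.gaussianDensity (PhiPosterior.matS φ M θ θ₀) t‖ₑ}) atTop (𝓝 0) := by
  intro ε hε
  have hθ₀ := R2.mem_finiteSet
  have := PhiPosterior.Model.isProbabilityMeasure_law hθ₀.1
  have hgrad_int := fun i => (hgrad i).integrable one_le_two
  have hmax := PhiPosterior.isMaxOn_integral_h hφ hθ hθ₀ hint R1.integrable_h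
  have hmean := R2.integral_gradH_eq_zero R1.integrable_h hgrad_int hhess hmax
  have hS := R2.posDef_matS R1.integrable_h hgrad_int hhess hmax hdet
  have hscore := PhiPosterior.aemeasurable_score hX hlaw fun i => (hgrad i).1.aemeasurable
  refine PhiPosterior.tendsto_measure_le_of_tight (Z := fun n ω =>
    √n * ‖PhiPosterior.score φ M θ θ₀ X n ω‖) ?_ (fun n => (hscore n).norm.const_mul _) ?_
    (fun b => ?_) (ENNReal.ofReal_pos.2 hε)
  · filter_upwards [eventually_ne_atTop 0] with n hn
    exact PhiPosterior.aemeasurable_lintegral_rescaledPosterior_sub hφ hθ hX hprior_int.1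
      (PhiPosterior.measurable_gaussianDensity _) hn (PhiPosterior.aemeasurable_center (hscore n))
  · exact fun _ =>
      PhiPosterior.exists_measure_lt_sqrt_mul_norm_empMean_le hX hindep hlaw hgrad hmean
  · filter_upwards [PhiPosterior.ae_isLocallyQuadratic_empMean hX hindep hlaw R2 hhess,
      PhiPosterior.ae_isWellSeparatedMax_empMean hφ hθ hθ₀ hint hsep R1] with ω hquad hsepω
    exact PhiPosterior.tendsto_lintegral_rescaledPosterior_sub inf_le_left hφ hθ hX hS
      R2.finiteSet_mem_nhds hprior_int hprior_cont hprior_ne_zero hquad hsepω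
      (mem_inf_of_right (mem_principal_self _))

theorem theorem1 {d : ℕ} {𝒳 : Type*} [MeasurableSpace 𝒳]
    (M : PhiPosterior.Model d 𝒳)
    (φ : ℝ → ℝ) (hφ : PhiPosterior.IsDivergenceGenerator φ)
    (θ θ₀ : PhiPosterior.Param d) (hθ : θ ∈ M.Θ) (hθ₀ : θ₀ ∈ M.Θ)
    (hint : ∀ α ∈ PhiPosterior.finiteSet φ M θ,
      Integrable (PhiPosterior.dualIntegrand φ M θ α) M.dom)
    (hsep : PhiPosterior.SeparatedFrom φ M θ θ₀)
    {Ω : Type*} [MeasurableSpace Ω] (μ : Measure Ω) [IsProbabilityMeasure μ]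
    (X : ℕ → Ω → 𝒳) (hX : ∀ i, Measurable (X i))
    (hindep : iIndepFun X μ) (hlaw : ∀ i, μ.map (X i) = M.law θ₀)
    (R1 : PhiPosterior.CondR1 φ M θ θ₀ μ X)
    (R2 : PhiPosterior.CondR2 φ M θ θ₀)
    (R3 : PhiPosterior.CondR3 φ M θ θ₀)
    (R4 : PhiPosterior.CondR4 φ M θ θ₀ μ X)
    (prior : PhiPosterior.Param d → ℝ)
    (hprior_nonneg : ∀ α ∈ M.Θ, 0 ≤ prior α)
    (hprior_int : IntegrableOn prior M.Θ)
    (hprior_moment : IntegrableOn (fun α => ‖α‖ * prior α) M.Θ)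
    (hprior_cont : ContinuousAt prior θ₀)
    (hprior_pos : 0 < prior θ₀) :
    ∀ ε : ℝ, 0 < ε →
      Tendsto (fun n : ℕ => μ {ω | ENNReal.ofReal ε ≤
        ∫⁻ t, ‖PhiPosterior.rescaledPosterior φ M θ θ₀ prior X n ω t
          - PhiPosterior.gaussianDensity (PhiPosterior.matS φ M θ θ₀) t‖ₑ}) atTop (𝓝 0) := by
  exact theorem1_general M φ hφ θ θ₀ hθ hint hsep μ X hX (fun _ _ => hindep.indepFun) hlaw R1
    R2.hasDominatedThirdPartials R3.integrable_hess R3.memLp_grad R3.det_S_ne_zero prior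
    (hprior_int.mono_set fun _ hα => hα.1) hprior_cont hprior_pos.ne'
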